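/- Consider arcs of great circles of positive length on the unit sphere in $\mathbb{R}^3$; the relative interior of an arc is the arc without its two endpoints. An arc $a$ *feeds into* an arc $a'$ if an endpoint of $a$ lies in the relative interior of $a'$. A *spherical occlusion diagram* (SOD) is a finite non-empty set $\mathcal S$ of such arcs with the following properties: (A1') each arc is shorter than a great semicircle (half of a great circle), and any two distinct arcs have disjoint relative interiors; (A2) each arc of $\mathcal S$ feeds into two arcs of $\mathcal S$; (A3) all arcs of $\mathcal S$ that feed into the same arc of $\mathcal S$ reach it from the same side. A *semicircle cover* of $\mathcal S$ is a set $\mathcal C$ of great semicircles such that each arc of $\mathcal S$, endpoints included, is contained in the relative interior of some great semicircle in $\mathcal C$. **Lemma.** Every semicircle cover of an SOD consists of at least eight great semicircles. -/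

import Mathlib

open scoped RealInnerProductSpace

namespace SphericalOcclusion

/-- The ambient Euclidean space; the sphere is its unit sphere about the origin. -/
abbrev E3 : Type := EuclideanSpace ℝ (Fin 3)

/-- A nondegenerate arc of a great circle of the unit sphere, given by its arc-length
parametrization `t ↦ cos t • start + sin t • dir` on `[0, length]`. -/
structure GreatArc where
  /-- the endpoint at parameter `0` -/
  start : E3
  /-- the unit tangent vector at `start` -/
  dir : E3
  /-- the length of the arc -/
  length : ℝ
  norm_start : ‖start‖ = 1
  norm_dir : ‖dir‖ = 1
  inner_start_dir : ⟪start, dir⟫ = 0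
  length_pos : 0 < length
  length_lt : length < 2 * Real.pi

namespace GreatArc

/-- The point of the great circle of `a` at (signed) distance `t` from `a.start` along it. -/
noncomputable def point (a : GreatArc) (t : ℝ) : E3 :=
  Real.cos t • a.start + Real.sin t • a.dir

/-- The arc as a closed set of points of the sphere. -/
def carrier (a : GreatArc) : Set E3 := a.point '' Set.Icc 0 a.length

/-- The relative interior: the arc without its two endpoints. -/
def relInterior (a : GreatArc) : Set E3 := a.point '' Set.Ioo 0 a.length

/-- The two endpoints of the arc. -/
def endpoints (a : GreatArc) : Set E3 := {a.point 0, a.point a.length}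

/-- Half of a great circle. -/
def IsGreatSemicircle (a : GreatArc) : Prop := a.length = Real.pi

/-- `a` feeds into `b` (`a` hits `b`, `b` blocks `a`): an endpoint of `a` lies in the relative
interior of `b`. -/
def FeedsInto (a b : GreatArc) : Prop := ∃ p ∈ a.endpoints, p ∈ b.relInterior

/-- `n` is a nonzero normal vector of the plane spanned by the great circle of `a`. It selects
the side `{x | 0 < ⟪n, x⟫}` of that great circle. -/
def IsNormal (a : GreatArc) (n : E3) : Prop :=
  n ≠ 0 ∧ ⟪n, a.start⟫ = 0 ∧ ⟪n, a.dir⟫ = 0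

end GreatArc

/-- A spherical occlusion diagram. An arc and its reversal have the same relative interior, so
`disjoint` also guarantees that no arc is listed twice with two parametrizations. -/
structure IsSOD (S : Set GreatArc) : Prop where
  finite : S.Finite
  nonempty : S.Nonempty
  /-- each arc is shorter than a great semicircle -/
  short : ∀ a ∈ S, a.length < Real.pi
  /-- any two arcs are internally disjoint -/
  disjoint : ∀ a ∈ S, ∀ b ∈ S, a ≠ b → Disjoint a.relInterior b.relInterior
  /-- each arc feeds into two arcs -/
  feeds_two : ∀ a ∈ S, ∃ b ∈ S, ∃ c ∈ S, b ≠ c ∧ a.FeedsInto b ∧ a.FeedsInto c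
  /-- All arcs that feed into the same arc reach it from the same side. (By `short` and
  `disjoint`, the relative interior of an arc that feeds into `a` does not meet the great circle
  of `a`, so it lies on one side of it.) -/
  same_side : ∀ a ∈ S, ∃ n : E3, a.IsNormal n ∧
    ∀ b ∈ S, b.FeedsInto a → ∀ x ∈ b.relInterior, 0 < ⟪n, x⟫

/-- `C` is a set of great semicircles such that each arc of `S` is contained in the relative
interior of one of them. -/
structure IsSemicircleCover (S C : Set GreatArc) : Prop where
  semicircle : ∀ c ∈ C, c.IsGreatSemicircle
  covers : ∀ a ∈ S, ∃ c ∈ C, a.carrier ⊆ c.relInterior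

end SphericalOcclusion

/-! ### Linear-algebraic model: arcs as planar cones in three-space. -/

namespace SphericalOcclusion

/-- The relatively open convex cone spanned by two vectors. -/
def openCone {V : Type*} [AddCommGroup V] [Module ℝ V] (p q : V) : Set V :=
  {x | ∃ s t : ℝ, 0 < s ∧ 0 < t ∧ x = s • p + t • q}

/-- A linear-algebraic model of a spherical occlusion diagram together with a semicircle cover.
The arc `a` is recorded by the cone over it, spanned by its two tips; `next a i` is the arc that is
hit by the tip `i` of `a`; `normal a` is positive on the arcs that feed into `a`; and `key a` is the
semicircle covering `a`, whose cone is the open half-plane of the combinations of `rim` and `apex`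
with positive coefficient at `apex`. -/
structure ConeDiagram (ι κ V : Type*) [AddCommGroup V] [Module ℝ V] where
  tip : ι → Bool → V
  normal : ι → V →ₗ[ℝ] ℝ
  next : ι → Bool → ι
  key : ι → κ
  rim : κ → V
  apex : κ → V
  height : κ → V →ₗ[ℝ] ℝ
  finrank_eq : Module.finrank ℝ V = 3
  tip_indep : ∀ a (s t : ℝ), s • tip a false + t • tip a true = 0 → s = 0 ∧ t = 0
  disjoint : ∀ a b x, x ∈ openCone (tip a false) (tip a true) →
    x ∈ openCone (tip b false) (tip b true) → a = b
  tip_mem : ∀ a i, tip a i ∈ openCone (tip (next a i) false) (tip (next a i) true)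
  normal_ne : ∀ a, normal a ≠ 0
  normal_tip : ∀ a i, normal a (tip a i) = 0
  normal_pos : ∀ a i, 0 < normal (next a i) (tip a (!i))
  height_rim : ∀ c, height c (rim c) = 0
  height_apex : ∀ c, height c (apex c) = 1
  tip_half : ∀ a i, ∃ s r : ℝ, 0 < r ∧ tip a i = s • rim (key a) + r • apex (key a)

/-- Three linearly independent vectors span a three-dimensional space. -/
theorem exists_eq_combination {V : Type*} [AddCommGroup V] [Module ℝ V]
    (hV : Module.finrank ℝ V = 3) {v₁ v₂ v₃ : V}
    (h : ∀ a b c : ℝ, a • v₁ + b • v₂ + c • v₃ = 0 → a = 0 ∧ b = 0 ∧ c = 0) (x : V) :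
    ∃ a b c : ℝ, x = a • v₁ + b • v₂ + c • v₃ := by
  have hli : LinearIndependent ℝ ![v₁, v₂, v₃] := by
    rw [Fintype.linearIndependent_iff]
    intro g hg
    simp only [Fin.sum_univ_three, Matrix.cons_val_zero, Matrix.cons_val_one,
      Matrix.cons_val_two] at hg
    obtain ⟨h0, h1, h2⟩ := h _ _ _ hg
    intro i
    fin_cases i <;> assumption
  have hspan := hli.span_eq_top_of_card_eq_finrank (by simp [hV])
  have hx : x ∈ Submodule.span ℝ (Set.range ![v₁, v₂, v₃]) := hspan ▸ Submodule.mem_top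
  obtain ⟨g, hg⟩ := (Submodule.mem_span_range_iff_exists_fun ℝ).1 hx
  exact ⟨g 0, g 1, g 2, by rw [← hg]; simp [Fin.sum_univ_three]⟩

namespace ConeDiagram

variable {ι κ V : Type*} [AddCommGroup V] [Module ℝ V] (D : ConeDiagram ι κ V)

/-- The relatively open cone over an arc. -/
def cone (a : ι) : Set V := openCone (D.tip a false) (D.tip a true)

/-- The open half-plane over a semicircle. -/
def half (c : κ) : Set V := {x | ∃ s r : ℝ, 0 < r ∧ x = s • D.rim c + r • D.apex c}

variable {D}

theorem mem_cone_iff {a : ι} (i : Bool) {x : V} :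
    x ∈ D.cone a ↔ ∃ s t : ℝ, 0 < s ∧ 0 < t ∧ x = s • D.tip a i + t • D.tip a (!i) := by
  cases i
  · rfl
  · constructor
    · rintro ⟨s, t, hs, ht, rfl⟩
      exact ⟨t, s, ht, hs, add_comm _ _⟩
    · rintro ⟨s, t, hs, ht, rfl⟩
      exact ⟨t, s, ht, hs, add_comm _ _⟩

theorem tip_indep' {a : ι} (i : Bool) {s t : ℝ} (h : s • D.tip a i + t • D.tip a (!i) = 0) :
    s = 0 ∧ t = 0 := by
  cases i
  · exact D.tip_indep a s t h
  · exact (D.tip_indep a t s (by rw [add_comm]; exact h)).symm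

theorem eq_of_mem_cone {a b : ι} {x : V} (ha : x ∈ D.cone a) (hb : x ∈ D.cone b) : a = b :=
  D.disjoint a b x ha hb

theorem tip_mem_cone (a : ι) (i : Bool) : D.tip a i ∈ D.cone (D.next a i) := D.tip_mem a i

theorem next_eq {a b : ι} {i : Bool} (h : D.tip b i ∈ D.cone a) : D.next b i = a :=
  eq_of_mem_cone (tip_mem_cone b i) h

theorem smul_mem_cone {a : ι} {x : V} (hx : x ∈ D.cone a) {r : ℝ} (hr : 0 < r) :
    r • x ∈ D.cone a := by
  obtain ⟨s, t, hs, ht, rfl⟩ := hx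
  exact ⟨r * s, r * t, by positivity, by positivity, by module⟩

theorem add_tip_mem_cone {a : ι} {x : V} (hx : x ∈ D.cone a) (i : Bool) {s t : ℝ} (hs : 0 < s)
    (ht : 0 ≤ t) : s • x + t • D.tip a i ∈ D.cone a := by
  obtain ⟨s', t', hs', ht', rfl⟩ := (mem_cone_iff i).1 hx
  exact (mem_cone_iff i).2 ⟨s * s' + t, s * t', by positivity, by positivity, by module⟩

theorem tip_notMem_cone (a : ι) (i : Bool) : D.tip a i ∉ D.cone a := by
  intro h
  obtain ⟨s, t, hs, ht, h⟩ := (mem_cone_iff i).1 h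
  have : (s - 1) • D.tip a i + t • D.tip a (!i) = 0 := by
    rw [sub_smul, one_smul, sub_add_eq_add_sub, ← h, sub_self]
  exact ht.ne' (tip_indep' i this).2

theorem normal_eq_zero {a : ι} {x : V} (hx : x ∈ D.cone a) : D.normal a x = 0 := by
  obtain ⟨s, t, hs, ht, rfl⟩ := hx
  simp [D.normal_tip]

theorem normal_pos_of_mem {a b : ι} {i : Bool} (h : D.next b i = a) {x : V}
    (hx : x ∈ D.cone b) : 0 < D.normal a x := by
  obtain ⟨s, t, hs, ht, rfl⟩ := (mem_cone_iff i).1 hx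
  have h1 : D.normal a (D.tip b i) = 0 := normal_eq_zero (h ▸ tip_mem_cone b i)
  have h2 := D.normal_pos b i
  rw [h] at h2
  simp only [map_add, map_smul, smul_eq_mul, h1]
  nlinarith [mul_pos ht h2]

theorem normal_tip_nonneg {a b : ι} {i : Bool} (h : D.next b i = a) (j : Bool) :
    0 ≤ D.normal a (D.tip b j) := by
  have h1 : D.normal a (D.tip b i) = 0 := normal_eq_zero (h ▸ tip_mem_cone b i)
  have h2 := D.normal_pos b i
  rw [h] at h2
  rcases Bool.eq_or_eq_not j i with rfl | rfl
  · exact h1.ge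
  · exact h2.le

/-- An arc feeding into `b` lies strictly on one side of `b`, so it cannot contain a tip of `b`. -/
theorem next_next_ne (b : ι) (i j : Bool) : D.next (D.next b i) j ≠ b := by
  intro h
  have h1 := normal_pos_of_mem h (tip_mem_cone b i)
  rw [D.normal_tip] at h1
  exact h1.false

theorem next_ne_self (b : ι) (i : Bool) : D.next b i ≠ b := by
  intro h
  exact tip_notMem_cone b i (by simpa [h] using tip_mem_cone (D := D) b i)

theorem next_ne_next_not (b : ι) (i : Bool) : D.next b i ≠ D.next b (!i) := by
  intro h
  have h1 := D.normal_pos b i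
  rw [h, normal_eq_zero (tip_mem_cone b (!i))] at h1
  exact h1.false

theorem eq_of_next_eq {b : ι} {i j : Bool} (h : D.next b i = D.next b j) : i = j := by
  rcases Bool.eq_or_eq_not j i with rfl | rfl
  · rfl
  · exact absurd h (next_ne_next_not b i)

/-- A vector in the kernel of a nonzero functional vanishing on an arc lies in the plane of
that arc. -/
theorem exists_eq_of_ker {a : ι} {f : V →ₗ[ℝ] ℝ} (hf : f ≠ 0) (h : ∀ i, f (D.tip a i) = 0) {x : V}
    (hx : f x = 0) : ∃ s t : ℝ, x = s • D.tip a false + t • D.tip a true := by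
  obtain ⟨v, hv⟩ : ∃ v, f v ≠ 0 := by
    by_contra! hcon
    exact hf (LinearMap.ext hcon)
  obtain ⟨s, t, r, rfl⟩ := exists_eq_combination D.finrank_eq
    (v₁ := D.tip a false) (v₂ := D.tip a true) (v₃ := v) (fun s t r hstr => by
      have h1 := congrArg f hstr
      simp only [map_add, map_smul, h, smul_eq_mul, mul_zero, zero_add, map_zero,
        mul_eq_zero, hv, or_false] at h1
      subst h1
      obtain ⟨h2, h3⟩ := D.tip_indep a s t (by simpa using hstr)
      exact ⟨h2, h3, rfl⟩) x
  simp only [map_add, map_smul, h, smul_eq_mul, mul_zero, zero_add, mul_eq_zero, hv,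
    or_false] at hx
  exact ⟨s, t, by simp [hx]⟩

/-- An arc and the arc it hits are not coplanar. -/
theorem not_coplanar {b : ι} {i : Bool} {f : V →ₗ[ℝ] ℝ} (hf : f ≠ 0)
    (h : ∀ j, f (D.tip (D.next b i) j) = 0) : f (D.tip b (!i)) ≠ 0 := by
  intro hx
  obtain ⟨s, t, hst⟩ := exists_eq_of_ker hf h hx
  have h1 := D.normal_pos b i
  rw [hst] at h1
  simp [D.normal_tip] at h1

theorem exists_tip_pos {f : V →ₗ[ℝ] ℝ} {a : ι} {x : V} (hx : x ∈ D.cone a) (h : 0 < f x) :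
    ∃ i, 0 < f (D.tip a i) := by
  by_contra! hcon
  obtain ⟨s, t, hs, ht, rfl⟩ := hx
  simp only [map_add, map_smul, smul_eq_mul] at h
  nlinarith [hcon false, hcon true]

end ConeDiagram
end SphericalOcclusion

/-! ### Half-planes of the cover and their incidences. -/

namespace SphericalOcclusion
namespace ConeDiagram

variable {ι κ V : Type*} [AddCommGroup V] [Module ℝ V] {D : ConeDiagram ι κ V}

theorem tip_mem_half (a : ι) (i : Bool) : D.tip a i ∈ D.half (D.key a) := D.tip_half a i

theorem comb_mem_half {c : κ} {x y : V} (hx : x ∈ D.half c) (hy : y ∈ D.half c) {s t : ℝ}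
    (hs : 0 < s) (ht : 0 ≤ t) : s • x + t • y ∈ D.half c := by
  obtain ⟨α, β, hβ, rfl⟩ := hx
  obtain ⟨γ, δ, hδ, rfl⟩ := hy
  exact ⟨s * α + t * γ, s * β + t * δ, by positivity, by module⟩

theorem cone_subset_half (a : ι) : D.cone a ⊆ D.half (D.key a) := by
  rintro x ⟨s, t, hs, ht, rfl⟩
  exact comb_mem_half (tip_mem_half a _) (tip_mem_half a _) hs ht.le

theorem height_pos {c : κ} {x : V} (hx : x ∈ D.half c) : 0 < D.height c x := by
  obtain ⟨s, r, hr, rfl⟩ := hx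
  simpa [D.height_rim, D.height_apex] using hr

/-- Every vector of the plane of a semicircle is a combination of the tips of any arc on it. -/
theorem exists_eq_of_mem_half {a : ι} (i : Bool) {x : V} (hx : x ∈ D.half (D.key a)) :
    ∃ s t : ℝ, x = s • D.tip a i + t • D.tip a (!i) := by
  obtain ⟨α, β, hβ, h1⟩ := D.tip_half a i
  obtain ⟨γ, δ, hδ, h2⟩ := D.tip_half a (!i)
  obtain ⟨s, r, hr, rfl⟩ := hx
  -- The determinant of the two tips in the basis `rim`, `apex`; the coefficients below are Cramer's
  -- rule.
  have hdet : α * δ - β * γ ≠ 0 := by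
    intro h0
    have : δ • D.tip a i + (-β) • D.tip a (!i) = 0 := by
      rw [h1, h2]
      have : δ • (α • D.rim (D.key a) + β • D.apex (D.key a)) +
        -β • (γ • D.rim (D.key a) + δ • D.apex (D.key a)) =
          (α * δ - β * γ) • D.rim (D.key a) := by module
      rw [this, h0, zero_smul]
    exact hδ.ne' (tip_indep' i this).1
  have hinv := mul_inv_cancel₀ hdet
  refine ⟨(s * δ - r * γ) * (α * δ - β * γ)⁻¹, (r * α - s * β) * (α * δ - β * γ)⁻¹, ?_⟩
  rw [h1, h2]
  match_scalars
  · linear_combination -s * hinv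
  · linear_combination -r * hinv

theorem eq_zero_on_half {a : ι} {f : V →ₗ[ℝ] ℝ} (h : ∀ i, f (D.tip a i) = 0) {x : V}
    (hx : x ∈ D.half (D.key a)) : f x = 0 := by
  obtain ⟨s, t, rfl⟩ := exists_eq_of_mem_half false hx
  simp [h]

theorem key_next_ne (b : ι) (i : Bool) : D.key (D.next b i) ≠ D.key b := by
  intro h
  have h1 := D.normal_pos b i
  rw [eq_zero_on_half (D.normal_tip _) (h ▸ tip_mem_half b (!i))] at h1
  exact h1.false

/-- A transversal plane meets a half-plane in a single ray. -/
theorem exists_smul_eq {c : κ} {f : V →ₗ[ℝ] ℝ} {x y w : V} (hx : x ∈ D.half c)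
    (hy : y ∈ D.half c) (hw : w ∈ D.half c) (fx : f x = 0) (fy : f y = 0) (fw : f w ≠ 0) :
    ∃ r : ℝ, 0 < r ∧ y = r • x := by
  obtain ⟨α, β, hβ, rfl⟩ := hx
  obtain ⟨γ, δ, hδ, rfl⟩ := hy
  obtain ⟨s, t, ht, rfl⟩ := hw
  simp only [map_add, map_smul, smul_eq_mul] at fx fy fw
  have hu : f (D.rim c) ≠ 0 := by
    intro h0
    simp only [h0, mul_zero, zero_add, mul_eq_zero, hβ.ne', false_or] at fx
    simp [h0, fx] at fw
  have hk : α * δ = γ * β := by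
    have : f (D.rim c) * (α * δ - γ * β) = 0 := by linear_combination δ * fx - β * fy
    rcases mul_eq_zero.1 this with h | h
    · exact absurd h hu
    · linarith
  refine ⟨δ / β, by positivity, ?_⟩
  match_scalars
  · field_simp
    linarith
  · field_simp

theorem exists_smul_tip_eq {b : ι} {i : Bool} {x : V} (h1 : x ∈ D.half (D.key b))
    (h2 : x ∈ D.half (D.key (D.next b i))) : ∃ r : ℝ, 0 < r ∧ x = r • D.tip b i :=
  exists_smul_eq (f := D.normal (D.next b i)) (tip_mem_half b i) h1 (tip_mem_half b (!i))
    (normal_eq_zero (tip_mem_cone b i)) (eq_zero_on_half (D.normal_tip _) h2)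
    (D.normal_pos b i).ne'

/-- Two coplanar cones with a common boundary ray on the same side of it intersect. -/
theorem eq_of_smul_tip_eq {b b' : ι} {i i' : Bool} {r : ℝ} (hr : 0 < r)
    (hk : D.key b = D.key b') (hn : D.next b i = D.next b' i')
    (h : D.tip b' i' = r • D.tip b i) : b = b' ∧ i = i' := by
  obtain ⟨α, β, hαβ⟩ := exists_eq_of_mem_half (D := D) i (hk ▸ tip_mem_half b' (!i'))
  have hN : D.normal (D.next b i) (D.tip b i) = 0 := normal_eq_zero (tip_mem_cone b i)
  have hp := D.normal_pos b i
  have hp' := D.normal_pos b' i'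
  have hβ : 0 < β := by
    rw [← hn, hαβ] at hp'
    simp only [map_add, map_smul, hN, smul_eq_mul, mul_zero, zero_add] at hp'
    exact pos_of_mul_pos_left hp' hp.le
  -- A point of the cone of `b'` close enough to the common boundary ray lies in the cone of `b`
  -- too.
  obtain ⟨ε, hε, hε'⟩ : ∃ ε : ℝ, 0 < ε ∧ 0 < r + ε * α := by
    refine ⟨r / (1 + |α|), by positivity, ?_⟩
    have h1 : 0 < 1 + |α| := by positivity
    have h2 : r + r / (1 + |α|) * α = r / (1 + |α|) * (1 + |α| + α) := by field_simp
    rw [h2]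
    have := neg_abs_le α
    have h3 : 0 < 1 + |α| + α := by linarith
    positivity
  have hbb : b = b' := by
    refine eq_of_mem_cone (D := D) (x := D.tip b' i' + ε • D.tip b' (!i')) ?_ ?_
    · refine (mem_cone_iff i).2 ⟨r + ε * α, ε * β, hε', by positivity, ?_⟩
      rw [hαβ, h]
      module
    · exact (mem_cone_iff i').2 ⟨1, ε, one_pos, hε, by module⟩
  subst hbb
  exact ⟨rfl, eq_of_next_eq hn⟩

/-- A pair of semicircles supports at most one incidence. -/
theorem eq_of_key_eq {b b' : ι} {i i' : Bool} (h1 : D.key b = D.key b')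
    (h2 : D.key (D.next b i) = D.key (D.next b' i')) : b = b' ∧ i = i' := by
  obtain ⟨r, hr, h⟩ := exists_smul_tip_eq (D := D) (b := b) (i := i) (x := D.tip b' i')
    (h1 ▸ tip_mem_half b' i') (h2 ▸ cone_subset_half _ (tip_mem_cone b' i'))
  refine eq_of_smul_tip_eq hr h1 (eq_of_mem_cone (x := D.tip b' i') ?_ (tip_mem_cone b' i')) h
  rw [h]
  exact smul_mem_cone (tip_mem_cone b i) hr

/-- Two transversal half-planes share at most one ray. Incidences in opposite order would both occur
on that ray, hence at the same hit arc, which would then share the semicircle of an arc hitting it.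
-/
theorem key_ne_of_key_eq {b b' : ι} {i i' : Bool} (h1 : D.key b = D.key (D.next b' i')) :
    D.key (D.next b i) ≠ D.key b' := by
  intro h2
  obtain ⟨r, hr, h⟩ := exists_smul_tip_eq (D := D) (b := b) (i := i) (x := D.tip b' i')
    (h1 ▸ cone_subset_half _ (tip_mem_cone b' i')) (h2 ▸ tip_mem_half b' i')
  have h3 : D.next b i = D.next b' i' := by
    refine eq_of_mem_cone (x := D.tip b' i') ?_ (tip_mem_cone b' i')
    rw [h]
    exact smul_mem_cone (tip_mem_cone b i) hr
  exact key_next_ne b i (h3 ▸ h1.symm)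

/-- The half-plane opposite to that of `a` is crossed by some arc, whose half-plane is then disjoint
from that of `a`. -/
theorem exists_disjoint_half [Finite ι] (a : ι) :
    ∃ b, Disjoint (D.half (D.key a)) (D.half (D.key b)) := by
  classical
  cases nonempty_fintype ι
  set Z := D.normal a
  -- The planes `f = m * Z` form the pencil through the line of `rim`; `f` is positive on the
  -- half-plane opposite to that of `a`.
  set f : V →ₗ[ℝ] ℝ := -D.height (D.key a) with hf
  have hZ : ∀ x ∈ D.half (D.key a), Z x = 0 := fun x hx => eq_zero_on_half (D.normal_tip a) hx
  have hZd : Z (D.apex (D.key a)) = 0 := hZ _ ⟨0, 1, one_pos, by simp⟩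
  let T : Finset (ι × Bool) := Finset.univ.filter fun q => 0 < Z (D.tip q.1 q.2)
  have hT : T.Nonempty := by
    have h0 : Z (D.tip a false) = 0 := D.normal_tip a false
    obtain ⟨s, t, hs, ht, h⟩ := tip_mem_cone (D := D) a false
    by_contra hcon
    have hle : ∀ b j, Z (D.tip b j) ≤ 0 := by
      intro b j
      by_contra! hlt
      exact hcon ⟨(b, j), by simp [T, hlt]⟩
    rw [h] at h0
    simp only [map_add, map_smul, smul_eq_mul] at h0
    have h1 := hle (D.next a false) false
    have h2 := hle (D.next a false) true
    have h3 : Z (D.tip (D.next a false) false) = 0 := by nlinarith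
    have h4 : Z (D.tip (D.next a false) true) = 0 := by nlinarith
    refine not_coplanar (D.normal_ne a) (b := a) (i := false) ?_ (D.normal_tip a _)
    rintro (_ | _) <;> assumption
  -- A half-plane rotating about that line, from the opposite half-plane into `0 < Z`, first meets a
  -- tip where `f / Z` is largest.
  obtain ⟨q, hq, hmax⟩ := T.exists_max_image (fun q => f (D.tip q.1 q.2) / Z (D.tip q.1 q.2)) hT
  have hqZ : 0 < Z (D.tip q.1 q.2) := by simpa [T] using hq
  set m : ℝ := f (D.tip q.1 q.2) / Z (D.tip q.1 q.2) with hm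
  set h : V →ₗ[ℝ] ℝ := f - m • Z with hh
  have hle : ∀ b j, 0 < Z (D.tip b j) → h (D.tip b j) ≤ 0 := by
    intro b j hb
    have := hmax (b, j) (by simp [T, hb])
    simp only at this
    rw [div_le_iff₀ hb] at this
    simp only [hh, LinearMap.sub_apply, LinearMap.smul_apply, smul_eq_mul]
    linarith
  have hne : h ≠ 0 := by
    intro h0
    have := congrArg (fun g : V →ₗ[ℝ] ℝ => g (D.apex (D.key a))) h0
    simp [hh, hf, hZd, D.height_apex] at this
  -- an arc through a maximum either leaves through the opposite half-plane or has constant ratio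
  have key : ∀ b x, x ∈ D.cone b → 0 < Z x → h x = 0 →
      (∃ b, Disjoint (D.half (D.key a)) (D.half (D.key b))) ∨ ∀ j, h (D.tip b j) = 0 := by
    intro b x hx hZx hhx
    obtain ⟨j, hj⟩ := exists_tip_pos hx hZx
    obtain ⟨s, t, hs, ht, rfl⟩ := (mem_cone_iff j).1 hx
    simp only [map_add, map_smul, smul_eq_mul] at hhx hZx
    have h1 := hle b j hj
    have conclude : h (D.tip b j) = 0 → h (D.tip b (!j)) = 0 → ∀ j, h (D.tip b j) = 0 := by
      intro e1 e2 j'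
      rcases Bool.eq_or_eq_not j' j with rfl | rfl <;> assumption
    rcases le_or_gt (Z (D.tip b (!j))) 0 with h2 | h2
    · set g := (-Z (D.tip b (!j))) • D.tip b j + Z (D.tip b j) • D.tip b (!j) with hg
      have hZg : Z g = 0 := by
        simp only [hg, map_add, map_smul, smul_eq_mul]
        ring
      have hgb : g ∈ D.half (D.key b) := by
        rw [hg, add_comm]
        exact comb_mem_half (tip_mem_half _ _) (tip_mem_half _ _) hj (by linarith)
      have hfg : f g = h g := by simp [hh, hZg]
      rcases eq_or_lt_of_le h1 with h3 | h3
      · right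
        have h4 : h (D.tip b (!j)) = 0 := by
          rw [h3, mul_zero, zero_add] at hhx
          exact (mul_eq_zero.1 hhx).resolve_left ht.ne'
        exact conclude h3 h4
      -- Here `h` changes sign along `b`, so at the crossing `g` with the plane of `a` the value `f
      -- g = h g` is positive: `g` lies opposite to the half-plane of `a`.
      · left
        refine ⟨b, Set.disjoint_left.2 fun y hy hyb => ?_⟩
        obtain ⟨r, hr, hyg⟩ := exists_smul_eq hyb hgb (tip_mem_half b j) (hZ y hy) hZg hj.ne'
        have h4 : 0 < h g := by
          simp only [hg, map_add, map_smul, smul_eq_mul]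
          have h5 : 0 < h (D.tip b (!j)) := by nlinarith
          nlinarith [mul_nonneg_of_nonpos_of_nonpos h2 h3.le, mul_pos hj h5,
            mul_pos_of_neg_of_neg h3 h3]
        rw [← hfg, hyg, map_smul, smul_eq_mul, hf, LinearMap.neg_apply] at h4
        nlinarith [height_pos hy]
    · right
      have h3 := hle b (!j) h2
      have h4 : h (D.tip b j) = 0 := by nlinarith
      have h5 : h (D.tip b (!j)) = 0 := by nlinarith
      exact conclude h4 h5
  have hq0 : h (D.tip q.1 q.2) = 0 := by
    simp only [hh, LinearMap.sub_apply, LinearMap.smul_apply, smul_eq_mul]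
    rw [hm, div_mul_cancel₀ _ hqZ.ne', sub_self]
  -- If `h` vanishes on the arc through the extremal tip, the argument is repeated at the arc hit by
  -- it; both cannot lie in the plane `h = 0`.
  rcases key _ _ (tip_mem_cone q.1 q.2) hqZ hq0 with hres | hb0
  · exact hres
  obtain ⟨j, hj⟩ := exists_tip_pos (tip_mem_cone q.1 q.2) hqZ
  rcases key _ _ (tip_mem_cone _ j) hj (hb0 j) with hres | hb1
  · exact hres
  · exact absurd (hb0 (!j)) (not_coplanar hne hb1)

end ConeDiagram
end SphericalOcclusion

/-! ### Affine chart of the hemisphere on the clean side of an arc. -/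

namespace SphericalOcclusion
namespace ConeDiagram

variable {ι κ V : Type*} [AddCommGroup V] [Module ℝ V] {D : ConeDiagram ι κ V}

/-- An arc that reaches the clean side of `a` does not meet the relative interior of `a`. -/
theorem crossing_notMem_cone {a b : ι} {j : Bool} (h1 : D.normal a (D.tip b j) < 0)
    (h2 : 0 ≤ D.normal a (D.tip b (!j))) :
    D.normal a (D.tip b (!j)) • D.tip b j + (-D.normal a (D.tip b j)) • D.tip b (!j)
      ∉ D.cone a := by
  intro hg
  rcases eq_or_lt_of_le h2 with h3 | h3
  · rw [← h3, zero_smul, zero_add] at hg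
    have h4 : D.tip b (!j) ∈ D.cone a := by
      have := smul_mem_cone hg (inv_pos.2 (neg_pos.2 h1))
      rwa [smul_smul, inv_mul_cancel₀ (neg_pos.2 h1).ne', one_smul] at this
    have := normal_tip_nonneg (next_eq h4) j
    linarith
  · have hb : D.normal a (D.tip b (!j)) • D.tip b j + (-D.normal a (D.tip b j)) • D.tip b (!j)
      ∈ D.cone b := (mem_cone_iff j).2 ⟨_, _, h3, by linarith, rfl⟩
    rw [eq_of_mem_cone hg hb, D.normal_tip] at h1
    exact h1.false

/-- Coordinates adapted to the clean side of an arc `a` whose tips (proportional to `ξ₁`, `ξ₂`) hit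
`x₁` and `x₂`: the hemisphere is `0 < Z`, the arc `a` bounds the quadrant `0 < X`, `0 < Y` at
infinity, `x₁` lies in the plane `Y = 0` and `x₂` in the plane `X = 0`. -/
structure Frame (D : ConeDiagram ι κ V) (a x₁ x₂ : ι) (j₁ j₂ : Bool) (X Y Z : V →ₗ[ℝ] ℝ)
    (ξ₁ ξ₂ : V) : Prop where
  X_ξ₁ : 0 < X ξ₁
  Y_ξ₁ : Y ξ₁ = 0
  Z_ξ₁ : Z ξ₁ = 0
  X_ξ₂ : X ξ₂ = 0
  Y_ξ₂ : 0 < Y ξ₂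
  Z_ξ₂ : Z ξ₂ = 0
  Z_e₁ : 0 < Z (D.tip x₁ j₁)
  Z_e₂ : 0 < Z (D.tip x₂ j₂)
  Z_e₁' : Z (D.tip x₁ (!j₁)) < 0
  Z_e₂' : Z (D.tip x₂ (!j₂)) < 0
  ξ₁_mem : ξ₁ ∈ D.cone x₁
  ξ₂_mem : ξ₂ ∈ D.cone x₂
  cone_a : ∀ s t : ℝ, 0 < s → 0 < t → s • ξ₁ + t • ξ₂ ∈ D.cone a
  X_eq : X = D.normal x₂
  Y_eq : Y = D.normal x₁
  Z_eq : Z = -D.normal a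

namespace Frame

variable {a x₁ x₂ : ι} {j₁ j₂ : Bool} {X Y Z : V →ₗ[ℝ] ℝ} {ξ₁ ξ₂ : V}

theorem symm (F : Frame D a x₁ x₂ j₁ j₂ X Y Z ξ₁ ξ₂) : Frame D a x₂ x₁ j₂ j₁ Y X Z ξ₂ ξ₁ where
  X_ξ₁ := F.Y_ξ₂
  Y_ξ₁ := F.X_ξ₂
  Z_ξ₁ := F.Z_ξ₂
  X_ξ₂ := F.Y_ξ₁
  Y_ξ₂ := F.X_ξ₁
  Z_ξ₂ := F.Z_ξ₁
  Z_e₁ := F.Z_e₂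
  Z_e₂ := F.Z_e₁
  Z_e₁' := F.Z_e₂'
  Z_e₂' := F.Z_e₁'
  ξ₁_mem := F.ξ₂_mem
  ξ₂_mem := F.ξ₁_mem
  cone_a s t hs ht := by
    rw [add_comm]
    exact F.cone_a t s ht hs
  X_eq := F.Y_eq
  Y_eq := F.X_eq
  Z_eq := F.Z_eq

variable (F : Frame D a x₁ x₂ j₁ j₂ X Y Z ξ₁ ξ₂)
include F

theorem exists_combination (w : V) :
    ∃ s t r : ℝ, w = s • ξ₁ + t • ξ₂ + r • D.tip x₁ j₁ := by
  refine exists_eq_combination D.finrank_eq (fun s t r h => ?_) w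
  have hZ := congrArg Z h
  have hX := congrArg X h
  have hY := congrArg Y h
  simp only [map_add, map_smul, smul_eq_mul, map_zero, F.Y_ξ₁, F.Z_ξ₁, F.X_ξ₂, F.Z_ξ₂,
    mul_zero, zero_add, add_zero, mul_eq_zero, F.Z_e₁.ne', or_false] at hZ hX hY
  subst hZ
  simp only [zero_mul, add_zero, mul_eq_zero, F.X_ξ₁.ne', F.Y_ξ₂.ne', or_false] at hX hY
  exact ⟨hX, hY, rfl⟩

theorem eq_of_coord_eq {w w' : V} (hX : X w = X w') (hY : Y w = Y w') (hZ : Z w = Z w') :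
    w = w' := by
  obtain ⟨s, t, r, h⟩ := F.exists_combination (w - w')
  have h1 := congrArg Z h
  have h2 := congrArg X h
  have h3 := congrArg Y h
  simp only [map_sub, map_add, map_smul, smul_eq_mul, F.Y_ξ₁, F.Z_ξ₁, F.X_ξ₂, F.Z_ξ₂, hX, hY, hZ,
    sub_self, mul_zero, zero_add, add_zero, zero_eq_mul, F.Z_e₁.ne', or_false] at h1 h2 h3
  subst h1
  simp only [zero_mul, add_zero, zero_eq_mul, F.X_ξ₁.ne', F.Y_ξ₂.ne', or_false] at h2 h3
  subst h2 h3
  rw [← sub_eq_zero, h]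
  simp

/-- In the chart `Z = 1` the plane of an arc becomes the line `l * X + m * Y = k`. -/
theorem exists_coord (N : V →ₗ[ℝ] ℝ) :
    ∃ l m k : ℝ, ∀ w, N w = l * X w + m * Y w - k * Z w := by
  have hX := F.X_ξ₁.ne'
  have hY := F.Y_ξ₂.ne'
  have hZ := F.Z_e₁.ne'
  refine ⟨N ξ₁ / X ξ₁, N ξ₂ / Y ξ₂, (N ξ₁ / X ξ₁ * X (D.tip x₁ j₁) +
    N ξ₂ / Y ξ₂ * Y (D.tip x₁ j₁) - N (D.tip x₁ j₁)) / Z (D.tip x₁ j₁), fun w => ?_⟩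
  obtain ⟨s, t, r, rfl⟩ := F.exists_combination w
  simp only [map_add, map_smul, smul_eq_mul, F.Y_ξ₁, F.Z_ξ₁, F.X_ξ₂, F.Z_ξ₂]
  field_simp
  ring

theorem Y_e₁ : Y (D.tip x₁ j₁) = 0 := by rw [F.Y_eq, D.normal_tip]

theorem X_e₂ : X (D.tip x₂ j₂) = 0 := F.symm.Y_e₁

theorem Y_eq_zero {r : V} (h : r ∈ D.cone x₁) : Y r = 0 := by
  rw [F.Y_eq, normal_eq_zero h]

theorem X_eq_zero {r : V} (h : r ∈ D.cone x₂) : X r = 0 := F.symm.Y_eq_zero h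

theorem Y_pos {b : ι} {j : Bool} (h : D.next b j = x₁) {x : V} (hx : x ∈ D.cone b) : 0 < Y x := by
  rw [F.Y_eq]
  exact normal_pos_of_mem h hx

theorem X_pos {b : ι} {j : Bool} (h : D.next b j = x₂) {x : V} (hx : x ∈ D.cone b) : 0 < X x :=
  F.symm.Y_pos h hx

/-- In the chart `x₁` is the ray on the axis `Y = 0` from `D.tip x₁ j₁` to infinity in direction
`ξ₁`. The inequality compares `X / Z` with its value at that end; clearing denominators admits the
point at infinity. -/
theorem mem_cone₁ {r : V} (hY : Y r = 0) (hZ : 0 ≤ Z r)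
    (h : X (D.tip x₁ j₁) * Z r < X r * Z (D.tip x₁ j₁)) : r ∈ D.cone x₁ := by
  have h1 := F.Z_e₁
  have h2 := F.X_ξ₁
  have h3 : r = ((X r - Z r / Z (D.tip x₁ j₁) * X (D.tip x₁ j₁)) / X ξ₁) • ξ₁ +
      (Z r / Z (D.tip x₁ j₁)) • D.tip x₁ j₁ := by
    apply F.eq_of_coord_eq <;>
      simp only [map_add, map_smul, smul_eq_mul, F.Y_ξ₁, F.Z_ξ₁, F.Y_e₁, hY]
    · field_simp
      ring
    · ring
    · field_simp
      ring
  rw [h3]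
  refine add_tip_mem_cone F.ξ₁_mem _ (div_pos ?_ h2) (by positivity)
  have : X r - Z r / Z (D.tip x₁ j₁) * X (D.tip x₁ j₁) =
      (X r * Z (D.tip x₁ j₁) - X (D.tip x₁ j₁) * Z r) / Z (D.tip x₁ j₁) := by
    field_simp
  rw [this]
  exact div_pos (by linarith) h1

theorem mem_cone₂ {r : V} (hX : X r = 0) (hZ : 0 ≤ Z r)
    (h : Y (D.tip x₂ j₂) * Z r < Y r * Z (D.tip x₂ j₂)) : r ∈ D.cone x₂ :=
  F.symm.mem_cone₁ hX hZ h

theorem mem_cone_base {r : V} (hX : 0 < X r) (hY : 0 < Y r) (hZ : Z r = 0) : r ∈ D.cone a := by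
  have h1 := F.X_ξ₁
  have h2 := F.Y_ξ₂
  have h3 : r = (X r / X ξ₁) • ξ₁ + (Y r / Y ξ₂) • ξ₂ := by
    apply F.eq_of_coord_eq <;>
      simp only [map_add, map_smul, smul_eq_mul, F.Y_ξ₁, F.Z_ξ₁, F.X_ξ₂, F.Z_ξ₂, hZ]
    · field_simp
      ring
    · field_simp
      ring
    · ring
  rw [h3]
  exact F.cone_a _ _ (by positivity) (by positivity)

theorem lt_of_mem_cone₁ {r : V} (h : r ∈ D.cone x₁) :
    X (D.tip x₁ j₁) * Z r < X r * Z (D.tip x₁ j₁) := by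
  obtain ⟨α, β, hα, hβ, rfl⟩ := (mem_cone_iff j₁).1 h
  obtain ⟨γ, δ, hγ, hδ, hξ⟩ := (mem_cone_iff j₁).1 F.ξ₁_mem
  have h1 := F.X_ξ₁
  have h2 := F.Z_ξ₁
  have h3 := F.Z_e₁
  rw [hξ] at h1 h2
  simp only [map_add, map_smul, smul_eq_mul] at h1 h2 ⊢
  have h4 : 0 < δ * (X (D.tip x₁ !j₁) * Z (D.tip x₁ j₁) -
      X (D.tip x₁ j₁) * Z (D.tip x₁ !j₁)) := by
    have := mul_pos h1 h3
    have e : δ * (X (D.tip x₁ !j₁) * Z (D.tip x₁ j₁) - X (D.tip x₁ j₁) * Z (D.tip x₁ !j₁)) =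
      (γ * X (D.tip x₁ j₁) + δ * X (D.tip x₁ !j₁)) * Z (D.tip x₁ j₁) := by
      linear_combination -X (D.tip x₁ j₁) * h2
    rwa [e]
  have h5 := pos_of_mul_pos_right h4 hδ.le
  nlinarith [mul_pos hβ h5]

theorem lt_of_mem_cone₂ {r : V} (h : r ∈ D.cone x₂) :
    Y (D.tip x₂ j₂) * Z r < Y r * Z (D.tip x₂ j₂) := F.symm.lt_of_mem_cone₁ h

theorem ne : x₁ ≠ x₂ := by
  rintro rfl
  have := F.X_ξ₁
  rw [F.X_eq_zero F.ξ₁_mem] at this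
  exact this.false

end Frame
end ConeDiagram
end SphericalOcclusion

/-! ### Forbidden configurations in the chart. -/

namespace SphericalOcclusion
namespace ConeDiagram

variable {ι κ V : Type*} [AddCommGroup V] [Module ℝ V] {D : ConeDiagram ι κ V}

theorem comb_mem_cone {a : ι} {x y : V} (hx : x ∈ D.cone a) (hy : y ∈ D.cone a) {s t : ℝ}
    (hs : 0 < s) (ht : 0 ≤ t) : s • x + t • y ∈ D.cone a := by
  obtain ⟨α, β, hα, hβ, rfl⟩ := hx
  obtain ⟨γ, δ, hγ, hδ, rfl⟩ := hy
  exact ⟨s * α + t * γ, s * β + t * δ, by positivity, by positivity, by module⟩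

namespace Frame

variable {a x₁ x₂ : ι} {j₁ j₂ : Bool} {X Y Z : V →ₗ[ℝ] ℝ} {ξ₁ ξ₂ : V}
variable (F : Frame D a x₁ x₂ j₁ j₂ X Y Z ξ₁ ξ₂)
include F

/-- `x₁` and `x₂` do not both hit an arc `u` that hits an arc `y` that hits `x₂`. -/
theorem not_common_next {u y : ι} {jp jr : Bool} (h₁ : D.next x₁ j₁ = u) (h₂ : D.next x₂ j₂ = u)
    (hp : 0 < Z (D.tip u jp)) (hpy : D.next u jp = y) (hr : 0 < Z (D.tip y jr))
    (hrx : D.next y jr = x₂) : False := by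
  obtain ⟨l, m, k, hN⟩ := F.exists_coord (D.normal u)
  have e₁u : D.tip x₁ j₁ ∈ D.cone u := h₁ ▸ tip_mem_cone x₁ j₁
  have e₂u : D.tip x₂ j₂ ∈ D.cone u := h₂ ▸ tip_mem_cone x₂ j₂
  have py : D.tip u jp ∈ D.cone y := hpy ▸ tip_mem_cone u jp
  have rx : D.tip y jr ∈ D.cone x₂ := hrx ▸ tip_mem_cone y jr
  have hl := normal_pos_of_mem h₁ F.ξ₁_mem
  have hm := normal_pos_of_mem h₂ F.ξ₂_mem
  have hN₁ := normal_eq_zero e₁u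
  have hN₂ := normal_eq_zero e₂u
  have hNp := D.normal_tip u jp
  rw [hN, F.Y_ξ₁, F.Z_ξ₁] at hl
  rw [hN, F.X_ξ₂, F.Z_ξ₂] at hm
  rw [hN, F.Y_e₁] at hN₁
  rw [hN, F.X_e₂] at hN₂
  rw [hN] at hNp
  have hZ₁ := F.Z_e₁
  have hZ₂ := F.Z_e₂
  have hl' : 0 < l := pos_of_mul_pos_left (by linarith) F.X_ξ₁.le
  have hm' : 0 < m := pos_of_mul_pos_left (by linarith) F.Y_ξ₂.le
  have hXp := F.X_pos hrx py
  have hXr := F.X_eq_zero rx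
  have hlt := F.lt_of_mem_cone₂ rx
  have hNr : 0 < m * Y (D.tip y jr) - k * Z (D.tip y jr) := by
    refine pos_of_mul_pos_left (b := Z (D.tip x₂ j₂)) ?_ hZ₂.le
    nlinarith [mul_lt_mul_of_pos_left hlt hm']
  -- For `k < 0` both ends lie on the negative half-axes, so both rays contain the origin `w` of the
  -- chart.
  have hk : 0 ≤ k := by
    by_contra! hk
    have hX : X (D.tip x₁ j₁) < 0 := by
      by_contra! h
      nlinarith [mul_neg_of_neg_of_pos hk hZ₁, mul_nonneg hl'.le h]
    have hY : Y (D.tip x₂ j₂) < 0 := by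
      by_contra! h
      nlinarith [mul_neg_of_neg_of_pos hk hZ₂, mul_nonneg hm'.le h]
    set w := X ξ₁ • D.tip x₁ j₁ - X (D.tip x₁ j₁) • ξ₁ with hw
    have wX : X w = 0 := by
      simp only [hw, map_sub, map_smul, smul_eq_mul]
      ring
    have wY : Y w = 0 := by simp [hw, F.Y_e₁, F.Y_ξ₁]
    have wZ : 0 < Z w := by
      simp only [hw, map_sub, map_smul, smul_eq_mul, F.Z_ξ₁, mul_zero, sub_zero]
      exact mul_pos F.X_ξ₁ hZ₁
    refine F.ne (eq_of_mem_cone (F.mem_cone₁ wY wZ.le ?_) (F.mem_cone₂ wX wZ.le ?_))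
    · rw [wX, zero_mul]
      exact mul_neg_of_neg_of_pos hX wZ
    · rw [wY, zero_mul]
      exact mul_neg_of_neg_of_pos hY wZ
  -- Otherwise this tip of `u` lies on the segment between the points where `x₁` and `x₂` hit `u`,
  -- hence inside `u`.
  have hYp : Y (D.tip u jp) < 0 := by
    by_contra! hYp
    have hk' : 0 < k := by
      refine pos_of_mul_pos_left (b := Z (D.tip u jp)) ?_ hp.le
      nlinarith [mul_pos hl' hXp, mul_nonneg hm'.le hYp]
    have hX : 0 < X (D.tip x₁ j₁) := by
      refine pos_of_mul_pos_right (a := l) ?_ hl'.le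
      nlinarith [mul_pos hk' hZ₁]
    have hY : 0 < Y (D.tip x₂ j₂) := by
      refine pos_of_mul_pos_right (a := m) ?_ hm'.le
      nlinarith [mul_pos hk' hZ₂]
    have heq : D.tip u jp = (X (D.tip u jp) / X (D.tip x₁ j₁)) • D.tip x₁ j₁ +
        (Y (D.tip u jp) / Y (D.tip x₂ j₂)) • D.tip x₂ j₂ := by
      apply F.eq_of_coord_eq <;>
        simp only [map_add, map_smul, smul_eq_mul, F.Y_e₁, F.X_e₂]
      · field_simp
        ring
      · field_simp
        ring
      · have e1 : Z (D.tip x₁ j₁) = l / k * X (D.tip x₁ j₁) := by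
          field_simp
          linarith
        have e2 : Z (D.tip x₂ j₂) = m / k * Y (D.tip x₂ j₂) := by
          field_simp
          linarith
        rw [e1, e2]
        field_simp
        linarith
    refine tip_notMem_cone (D := D) u jp ?_
    rw [heq]
    exact comb_mem_cone e₁u e₂u (by positivity) (by positivity)
  have hYr : 0 < Y (D.tip y jr) := by
    refine pos_of_mul_pos_right (a := m) ?_ hm'.le
    nlinarith [mul_nonneg hk hr.le]
  -- The crossing of `y` with the axis `Y = 0`. It is on the positive side of `u`, so beyond the end
  -- of `x₁`, hence on `x₁`.
  set o := Y (D.tip y jr) • D.tip u jp + (-Y (D.tip u jp)) • D.tip y jr with ho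
  have oy : o ∈ D.cone y := add_tip_mem_cone py _ hYr (by linarith)
  have oX : X o = Y (D.tip y jr) * X (D.tip u jp) := by simp [ho, hXr]
  have oY : Y o = 0 := by
    simp only [ho, map_add, map_smul, smul_eq_mul]
    ring
  have oZ : Z o = Y (D.tip y jr) * Z (D.tip u jp) - Y (D.tip u jp) * Z (D.tip y jr) := by
    simp only [ho, map_add, map_smul, smul_eq_mul]
    ring
  have oN : 0 < l * X o - k * Z o := by
    rw [oX, oZ]
    have := mul_pos (neg_pos.2 hYp) hNr
    have e : l * (Y (D.tip y jr) * X (D.tip u jp)) -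
      k * (Y (D.tip y jr) * Z (D.tip u jp) - Y (D.tip u jp) * Z (D.tip y jr)) =
        -Y (D.tip u jp) * (m * Y (D.tip y jr) - k * Z (D.tip y jr)) := by
      linear_combination Y (D.tip y jr) * hNp
    rwa [e]
  have ox : o ∈ D.cone x₁ := by
    refine F.mem_cone₁ oY ?_ ?_
    · rw [oZ]
      nlinarith [mul_pos hYr hp, mul_pos (neg_pos.2 hYp) hr]
    · refine lt_of_mul_lt_mul_left (a := l) ?_ hl'.le
      have e : l * (X o * Z (D.tip x₁ j₁)) - l * (X (D.tip x₁ j₁) * Z o) =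
          Z (D.tip x₁ j₁) * (l * X o - k * Z o) := by
        linear_combination (-Z o) * hN₁
      have := mul_pos hZ₁ oN
      linarith
  have := eq_of_mem_cone oy ox
  exact next_next_ne x₁ j₁ jp (by rw [h₁, hpy, this])

/-- The arcs hit by `x₁` and `x₂` do not hit `x₂` and `x₁` crosswise. -/
theorem not_crosswise {u₁ u₂ : ι} {k₁ k₂ : Bool} (h₁ : D.next x₁ j₁ = u₁)
    (h₂ : D.next x₂ j₂ = u₂) (hu : u₁ ≠ u₂) (hr₁ : 0 < Z (D.tip u₁ k₁))
    (hr₂ : 0 < Z (D.tip u₂ k₂)) (hux₁ : D.next u₁ k₁ = x₂) (hux₂ : D.next u₂ k₂ = x₁) : False := by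
  have e₁u : D.tip x₁ j₁ ∈ D.cone u₁ := h₁ ▸ tip_mem_cone x₁ j₁
  have e₂u : D.tip x₂ j₂ ∈ D.cone u₂ := h₂ ▸ tip_mem_cone x₂ j₂
  have r₁x : D.tip u₁ k₁ ∈ D.cone x₂ := hux₁ ▸ tip_mem_cone u₁ k₁
  have r₂x : D.tip u₂ k₂ ∈ D.cone x₁ := hux₂ ▸ tip_mem_cone u₂ k₂
  have hX := F.X_pos hux₁ e₁u
  have hY := F.Y_pos hux₂ e₂u
  have hlt₁ := F.lt_of_mem_cone₁ r₂x
  have hlt₂ := F.lt_of_mem_cone₂ r₁x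
  have hXr : 0 < X (D.tip u₂ k₂) := by
    refine pos_of_mul_pos_left (b := Z (D.tip x₁ j₁)) ?_ F.Z_e₁.le
    nlinarith [mul_pos hX hr₂]
  have hYr : 0 < Y (D.tip u₁ k₁) := by
    refine pos_of_mul_pos_left (b := Z (D.tip x₂ j₂)) ?_ F.Z_e₂.le
    nlinarith [mul_pos hY hr₁]
  set c := X (D.tip u₂ k₂) * Z (D.tip x₁ j₁) - X (D.tip x₁ j₁) * Z (D.tip u₂ k₂) with hc
  set b := Y (D.tip u₁ k₁) * Z (D.tip x₂ j₂) - Y (D.tip x₂ j₂) * Z (D.tip u₁ k₁) with hb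
  have hc0 : 0 < c := by linarith
  have hb0 : 0 < b := by linarith
  -- On each axis the end of the ray is nearer to the origin than the tip hitting the ray, so the
  -- segments of `u₁` and `u₂` cross; both sides represent the crossing.
  have heq : (Y (D.tip u₁ k₁) * c) • D.tip x₂ j₂ + (X (D.tip x₁ j₁) * b) • D.tip u₂ k₂ =
      (X (D.tip u₂ k₂) * b) • D.tip x₁ j₁ + (Y (D.tip x₂ j₂) * c) • D.tip u₁ k₁ := by
    apply F.eq_of_coord_eq <;>
      simp only [map_add, map_smul, smul_eq_mul, F.Y_e₁, F.X_e₂, F.X_eq_zero r₁x, F.Y_eq_zero r₂x]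
    · ring
    · ring
    · rw [hc, hb]
      ring
  refine hu (eq_of_mem_cone (add_tip_mem_cone e₁u k₁ (mul_pos hXr hb0) (mul_pos hY hc0).le) ?_)
  rw [← heq]
  exact add_tip_mem_cone e₂u k₂ (mul_pos hYr hc0) (mul_pos hX hb0).le

/-- The arc hit by `x₂` does not hit `x₁` if it is hit by the arc hit by `x₁`. -/
theorem not_chain {u₁ u₂ : ι} {k k' : Bool} (h₁ : D.next x₁ j₁ = u₁)
    (h₂ : D.next x₂ j₂ = u₂) (hr : 0 < Z (D.tip u₂ k)) (hr' : Z (D.tip u₂ (!k)) ≤ 0)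
    (hux : D.next u₂ k = x₁) (huu : D.next u₁ k' = u₂) : False := by
  obtain ⟨l, m, c, hN⟩ := F.exists_coord (D.normal u₂)
  have e₁u : D.tip x₁ j₁ ∈ D.cone u₁ := h₁ ▸ tip_mem_cone x₁ j₁
  have e₂u : D.tip x₂ j₂ ∈ D.cone u₂ := h₂ ▸ tip_mem_cone x₂ j₂
  have rx : D.tip u₂ k ∈ D.cone x₁ := hux ▸ tip_mem_cone u₂ k
  have hm := normal_pos_of_mem h₂ F.ξ₂_mem
  have hN₁ := normal_pos_of_mem huu e₁u
  have hN₂ := normal_eq_zero e₂u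
  have hNr := D.normal_tip u₂ k
  have hNr' := D.normal_tip u₂ (!k)
  have hYr := F.Y_eq_zero rx
  rw [hN, F.X_ξ₂, F.Z_ξ₂] at hm
  rw [hN, F.Y_e₁] at hN₁
  rw [hN, F.X_e₂] at hN₂
  rw [hN, hYr] at hNr
  rw [hN] at hNr'
  have hZ₁ := F.Z_e₁
  have hZ₂ := F.Z_e₂
  have hm' : 0 < m := pos_of_mul_pos_left (by linarith) F.Y_ξ₂.le
  have hY := F.Y_pos hux e₂u
  have hc : 0 < c := pos_of_mul_pos_left (by nlinarith [mul_pos hm' hY]) hZ₂.le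
  have hlt := F.lt_of_mem_cone₁ rx
  have hlX : 0 < l * X (D.tip u₂ k) := by nlinarith [mul_pos hc hr]
  -- For `l ≤ 0`, `u₂` leaves the hemisphere through the quadrant at infinity, which is `a`. For `l
  -- > 0`, the tip of `u₂` lies beyond the end of `x₁`, so that end is on the negative side of `u₂`,
  -- against `hN₁`.
  rcases le_or_gt l 0 with hl | hl
  · have hl' : l < 0 := lt_of_le_of_ne hl (by rintro rfl; simp at hlX)
    have hX : X (D.tip u₂ k) < 0 := by
      by_contra! h
      nlinarith [mul_nonneg (neg_nonneg.2 hl) h]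
    set g := (-Z (D.tip u₂ (!k))) • D.tip u₂ k + Z (D.tip u₂ k) • D.tip u₂ (!k) with hg
    have gZ : Z g = 0 := by
      simp only [hg, map_add, map_smul, smul_eq_mul]
      ring
    have gY : 0 < Y g := by
      obtain ⟨α, β, hα, hβ, h⟩ := (mem_cone_iff k).1 e₂u
      have h3 := congrArg Y h
      simp only [map_add, map_smul, smul_eq_mul, hYr, mul_zero, zero_add] at h3
      have h4 : 0 < Y (D.tip u₂ (!k)) := pos_of_mul_pos_right (h3 ▸ hY) hβ.le
      simp only [hg, map_add, map_smul, smul_eq_mul, hYr, mul_zero, zero_add]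
      exact mul_pos hr h4
    have gN : l * X g + m * Y g = 0 := by
      simp only [hg, map_add, map_smul, smul_eq_mul, hYr]
      linear_combination (-Z (D.tip u₂ (!k))) * hNr + Z (D.tip u₂ k) * hNr'
    have gX : 0 < X g := by
      by_contra! h
      nlinarith [mul_pos hm' gY, mul_nonneg (neg_nonneg.2 hl) (neg_nonneg.2 h)]
    have hgc := F.mem_cone_base gX gY gZ
    refine crossing_notMem_cone (D := D) (a := a) (b := u₂) (j := k) ?_ ?_ ?_
    · rw [F.Z_eq] at hr
      simpa using hr
    · rw [F.Z_eq] at hr'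
      simpa using hr'
    · rw [hg, F.Z_eq] at hgc
      simpa using hgc
  · have h1 := mul_pos hr hN₁
    have h2 := mul_lt_mul_of_pos_left hlt hl
    nlinarith

/-- If `x₂` hits `x₁`, then the arc hit by `x₁` does not hit an arc that hits `x₂`. -/
theorem not_return {u₁ u₂ : ι} {k l : Bool} (h₂ : D.next x₂ j₂ = x₁) (h₁ : D.next x₁ j₁ = u₁)
    (hq : 0 < Z (D.tip u₁ k)) (hu : D.next u₁ k = u₂) (hs : 0 < Z (D.tip u₂ l))
    (hux : D.next u₂ l = x₂) : False := by
  have e₁u : D.tip x₁ j₁ ∈ D.cone u₁ := h₁ ▸ tip_mem_cone x₁ j₁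
  have e₂x : D.tip x₂ j₂ ∈ D.cone x₁ := h₂ ▸ tip_mem_cone x₂ j₂
  have qu : D.tip u₁ k ∈ D.cone u₂ := hu ▸ tip_mem_cone u₁ k
  have sx : D.tip u₂ l ∈ D.cone x₂ := hux ▸ tip_mem_cone u₂ l
  have hZ₁ := F.Z_e₁
  have hZ₂ := F.Z_e₂
  have hY₂ : Y (D.tip x₂ j₂) = 0 := F.Y_eq_zero e₂x
  have hX₁ : X (D.tip x₁ j₁) < 0 := by
    have := F.lt_of_mem_cone₁ e₂x
    rw [F.X_e₂, zero_mul] at this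
    by_contra! h
    nlinarith [mul_nonneg h hZ₂.le]
  have hXq := F.X_pos hux qu
  have hXs := F.X_eq_zero sx
  have hYs : 0 < Y (D.tip u₂ l) := by
    have := F.lt_of_mem_cone₂ sx
    rw [hY₂, zero_mul] at this
    exact pos_of_mul_pos_left this hZ₂.le
  -- The end of `x₂` is the origin of the chart, that of `x₁` has `X < 0`. Either `u₁` crosses the
  -- axis `X = 0` at the origin or on `x₂`, or `u₂` crosses the axis `Y = 0` on `x₁`.
  rcases le_or_gt 0 (Y (D.tip u₁ k)) with hY | hY
  · set o := X (D.tip u₁ k) • D.tip x₁ j₁ + (-X (D.tip x₁ j₁)) • D.tip u₁ k with ho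
    have ou : o ∈ D.cone u₁ := add_tip_mem_cone e₁u _ hXq (by linarith)
    have oX : X o = 0 := by
      simp only [ho, map_add, map_smul, smul_eq_mul]
      ring
    have oY : Y o = -X (D.tip x₁ j₁) * Y (D.tip u₁ k) := by simp [ho, F.Y_e₁]
    have oZ : 0 < Z o := by
      simp only [ho, map_add, map_smul, smul_eq_mul]
      nlinarith [mul_pos hXq hZ₁, mul_pos (neg_pos.2 hX₁) hq]
    rcases eq_or_lt_of_le hY with hY | hY
    · have h3 : o = (Z o / Z (D.tip x₂ j₂)) • D.tip x₂ j₂ := by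
        apply F.eq_of_coord_eq <;>
          simp only [map_smul, smul_eq_mul, F.X_e₂, hY₂, oX, oY, ← hY, mul_zero]
        field_simp
      have h4 : o ∈ D.cone x₁ := by
        rw [h3]
        exact smul_mem_cone e₂x (by positivity)
      exact next_ne_self x₁ j₁ (h₁.trans (eq_of_mem_cone ou h4))
    · have h4 : o ∈ D.cone x₂ := by
        refine F.mem_cone₂ oX oZ.le ?_
        rw [hY₂, oY, zero_mul]
        exact mul_pos (mul_pos (neg_pos.2 hX₁) hY) hZ₂
      have h5 := eq_of_mem_cone ou h4
      exact next_next_ne x₂ j₂ j₁ (by rw [h₂, h₁, h5])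
  · set o := Y (D.tip u₂ l) • D.tip u₁ k + (-Y (D.tip u₁ k)) • D.tip u₂ l with ho
    have ou : o ∈ D.cone u₂ := add_tip_mem_cone qu _ hYs (by linarith)
    have oX : 0 < X o := by
      simp only [ho, map_add, map_smul, smul_eq_mul, hXs, mul_zero, add_zero]
      exact mul_pos hYs hXq
    have oY : Y o = 0 := by
      simp only [ho, map_add, map_smul, smul_eq_mul]
      ring
    have oZ : 0 < Z o := by
      simp only [ho, map_add, map_smul, smul_eq_mul]
      nlinarith [mul_pos hYs hq, mul_pos (neg_pos.2 hY) hs]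
    have ox : o ∈ D.cone x₁ := by
      refine F.mem_cone₁ oY oZ.le ?_
      nlinarith [mul_pos oX hZ₁, mul_pos (neg_pos.2 hX₁) oZ]
    have h5 := eq_of_mem_cone ou ox
    exact next_next_ne x₁ j₁ k (by rw [h₁, hu, h5])

end Frame
end ConeDiagram
end SphericalOcclusion

/-! ### Arcs meeting the clean hemisphere. -/

namespace SphericalOcclusion
namespace ConeDiagram

variable {ι κ V : Type*} [AddCommGroup V] [Module ℝ V] {D : ConeDiagram ι κ V}

theorem exists_sides (a : ι) (i : Bool) : ∃ j, D.normal a (D.tip (D.next a i) j) < 0 ∧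
    0 < D.normal a (D.tip (D.next a i) (!j)) := by
  obtain ⟨s, t, hs, ht, h⟩ := tip_mem_cone (D := D) a i
  have h0 := D.normal_tip a i
  rw [h] at h0
  simp only [map_add, map_smul, smul_eq_mul] at h0
  rcases lt_trichotomy (D.normal a (D.tip (D.next a i) false)) 0 with h1 | h1 | h1
  · refine ⟨false, h1, pos_of_mul_pos_right (a := t) ?_ ht.le⟩
    have := mul_neg_of_pos_of_neg hs h1
    simp only [Bool.not_false]
    linarith
  · rw [h1, mul_zero, zero_add] at h0
    have h2 := (mul_eq_zero.1 h0).resolve_left ht.ne'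
    exact absurd (D.normal_tip a (!i)) (not_coplanar (D.normal_ne a) (by
      rintro (_ | _) <;> assumption))
  · refine ⟨true, ?_, h1⟩
    by_contra! h2
    nlinarith [mul_pos hs h1, mul_nonneg ht.le h2]

theorem eq_or_of_card_le_four {M : Finset ι} (hM : M.card ≤ 4) {p q r s : ι} (hp : p ∈ M)
    (hq : q ∈ M) (hr : r ∈ M) (hs : s ∈ M) (h₁ : p ≠ q) (h₂ : p ≠ r) (h₃ : p ≠ s) (h₄ : q ≠ r)
    (h₅ : q ≠ s) (h₆ : r ≠ s) : M.card = 4 ∧ ∀ b ∈ M, b = p ∨ b = q ∨ b = r ∨ b = s := by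
  classical
  have hc : ({p, q, r, s} : Finset ι).card = 4 := by
    rw [Finset.card_insert_of_notMem (by simp [h₁, h₂, h₃]),
      Finset.card_insert_of_notMem (by simp [h₄, h₅]), Finset.card_pair h₆]
  have hsub : ({p, q, r, s} : Finset ι) ⊆ M := by
    simp [Finset.insert_subset_iff, hp, hq, hr, hs]
  have heq := Finset.eq_of_subset_of_card_le hsub (by omega)
  refine ⟨by rw [← heq, hc], fun b hb => ?_⟩
  rw [← heq] at hb
  simpa using hb

theorem Frame.leaves {a x₁ x₂ : ι} {j₁ j₂ : Bool} {X Y Z : V →ₗ[ℝ] ℝ} {ξ₁ ξ₂ : V}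
    (F : Frame D a x₁ x₂ j₁ j₂ X Y Z ξ₁ ξ₂) {b : ι} {j : Bool} (h₁ : 0 < Z (D.tip b j))
    (h₂ : Z (D.tip b (!j)) ≤ 0) :
    ∃ j, D.normal a (D.tip b j) < 0 ∧ 0 ≤ D.normal a (D.tip b (!j)) := by
  rw [F.Z_eq] at h₁ h₂
  exact ⟨j, by simpa using h₁, by simpa using h₂⟩

section Fintype

variable [Fintype ι]

open Classical in
variable (D) in
/-- The arcs meeting the hemisphere on the clean side of `a`. -/
noncomputable def upper (a : ι) : Finset ι :=
  Finset.univ.filter fun b => ∃ j, D.normal a (D.tip b j) < 0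

open Classical in
variable (D) in
/-- The incidences at an arc `a`: the arcs feeding into it, each with the tip that does so. -/
noncomputable def feeders (a : ι) : Finset (ι × Bool) :=
  Finset.univ.filter fun q => D.next q.1 q.2 = a

theorem mem_upper {a b : ι} : b ∈ D.upper a ↔ ∃ j, D.normal a (D.tip b j) < 0 := by
  simp [upper]

theorem mem_feeders {a : ι} {q : ι × Bool} : q ∈ D.feeders a ↔ D.next q.1 q.2 = a := by
  simp [feeders]

theorem self_notMem_upper (a : ι) : a ∉ D.upper a := by
  simp [mem_upper, D.normal_tip]

theorem notMem_upper_of_next {a b : ι} {i : Bool} (h : D.next b i = a) : b ∉ D.upper a := by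
  rw [mem_upper]
  rintro ⟨j, hj⟩
  exact hj.not_ge (normal_tip_nonneg h j)

/-- The clean side of `a` is met by exactly four arcs, all of which leave it, and some arc of the
diagram is hit at least three times. -/
def Tight (D : ConeDiagram ι κ V) (a : ι) : Prop :=
  (D.upper a).card = 4 ∧
  (∀ b ∈ D.upper a, ∃ j, D.normal a (D.tip b j) < 0 ∧ 0 ≤ D.normal a (D.tip b (!j))) ∧
  ∃ x, 3 ≤ (D.feeders x).card

namespace Frame

variable {a x₁ x₂ : ι} {j₁ j₂ : Bool} {X Y Z : V →ₗ[ℝ] ℝ} {ξ₁ ξ₂ : V}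
variable (F : Frame D a x₁ x₂ j₁ j₂ X Y Z ξ₁ ξ₂)
include F

theorem mem_upper_iff {b : ι} : b ∈ D.upper a ↔ ∃ j, 0 < Z (D.tip b j) := by
  simp [mem_upper, F.Z_eq]

theorem next_mem_upper {b : ι} {j : Bool} (h : 0 < Z (D.tip b j)) : D.next b j ∈ D.upper a :=
  F.mem_upper_iff.2 (exists_tip_pos (tip_mem_cone b j) h)

/-- The chain `x₂`, `x₁`, `u₁`, `u₂` of successive hits has four different members. Without a fifth
arc `u₂` can only hit `x₁` (`not_return` excludes `x₂`), so `x₁` is hit by `a`, `x₂` and `u₂`. -/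
theorem tight_of_hit {i : Bool} (hM : (D.upper a).card ≤ 4) (ha : D.next a i = x₁)
    (h : D.next x₂ j₂ = x₁) : D.Tight a := by
  have mx₁ : x₁ ∈ D.upper a := F.mem_upper_iff.2 ⟨_, F.Z_e₁⟩
  have mx₂ : x₂ ∈ D.upper a := F.mem_upper_iff.2 ⟨_, F.Z_e₂⟩
  obtain ⟨u₁, hu₁⟩ : ∃ u, D.next x₁ j₁ = u := ⟨_, rfl⟩
  have mu₁ : u₁ ∈ D.upper a := hu₁ ▸ F.next_mem_upper F.Z_e₁
  have hu₁x₁ : u₁ ≠ x₁ := hu₁ ▸ next_ne_self _ _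
  have hu₁x₂ : u₁ ≠ x₂ := by
    rintro rfl
    exact next_next_ne x₁ j₁ j₂ (by rw [hu₁, h])
  obtain ⟨k, hk⟩ := F.mem_upper_iff.1 mu₁
  have nx₁ : ∀ l, D.next u₁ l ≠ x₁ := fun l hl => next_next_ne x₁ j₁ l (by rw [hu₁, hl])
  have nx₂ : ∀ l, D.next u₁ l ≠ x₂ := by
    intro l hl
    have h1 := F.X_pos hl (hu₁ ▸ tip_mem_cone x₁ j₁)
    have h2 := F.lt_of_mem_cone₁ (h ▸ tip_mem_cone x₂ j₂)
    rw [F.X_e₂, zero_mul] at h2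
    nlinarith [mul_pos h1 F.Z_e₂]
  obtain ⟨u₂, hu₂⟩ : ∃ u, D.next u₁ k = u := ⟨_, rfl⟩
  have mu₂ : u₂ ∈ D.upper a := hu₂ ▸ F.next_mem_upper hk
  have hu₂u₁ : u₂ ≠ u₁ := hu₂ ▸ next_ne_self _ _
  have hu₂x₁ : u₂ ≠ x₁ := hu₂ ▸ nx₁ k
  have hu₂x₂ : u₂ ≠ x₂ := hu₂ ▸ nx₂ k
  obtain ⟨hcard, hfour⟩ := eq_or_of_card_le_four hM mx₁ mx₂ mu₁ mu₂ F.ne hu₁x₁.symm hu₂x₁.symm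
    hu₁x₂.symm hu₂x₂.symm hu₂u₁.symm
  have next_u₂ : ∀ l, 0 < Z (D.tip u₂ l) → D.next u₂ l = x₁ := by
    intro l hl
    rcases hfour _ (F.next_mem_upper hl) with h' | h' | h' | h'
    · exact h'
    · exact (F.not_return h hu₁ hk hu₂ hl h').elim
    · exact (next_next_ne u₁ k l (by rw [hu₂, h'])).elim
    · exact (next_ne_self _ _ h').elim
  have next_u₁ : ∀ l, 0 < Z (D.tip u₁ l) → D.next u₁ l = u₂ := by
    intro l hl
    rcases hfour _ (F.next_mem_upper hl) with h' | h' | h' | h'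
    · exact (nx₁ l h').elim
    · exact (nx₂ l h').elim
    · exact (next_ne_self _ _ h').elim
    · exact h'
  obtain ⟨l, hl⟩ := F.mem_upper_iff.1 mu₂
  refine ⟨hcard, fun b hb => ?_, x₁, ?_⟩
  · rcases hfour b hb with rfl | rfl | rfl | rfl
    · exact F.leaves F.Z_e₁ F.Z_e₁'.le
    · exact F.leaves F.Z_e₂ F.Z_e₂'.le
    -- The two ends of an arc hit different arcs, but inside the hemisphere only one target is
    -- available.
    · refine F.leaves hk (not_lt.1 fun h' => ?_)
      exact next_ne_next_not b k ((next_u₁ _ hk).trans (next_u₁ _ h').symm)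
    · refine F.leaves hl (not_lt.1 fun h' => ?_)
      exact next_ne_next_not b l ((next_u₂ _ hl).trans (next_u₂ _ h').symm)
  · have hax₂ : a ≠ x₂ := (ne_of_mem_of_not_mem mx₂ (self_notMem_upper a)).symm
    have hau₂ : a ≠ u₂ := (ne_of_mem_of_not_mem mu₂ (self_notMem_upper a)).symm
    exact Finset.two_lt_card.2 ⟨(a, i), mem_feeders.2 ha, (x₂, j₂), mem_feeders.2 h,
      (u₂, l), mem_feeders.2 (next_u₂ l hl), fun e => hax₂ (congrArg Prod.fst e),
      fun e => hau₂ (congrArg Prod.fst e), fun e => hu₂x₂.symm (congrArg Prod.fst e)⟩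

/-- With only four arcs, the ends of `x₁` and `x₂` hit either one arc, excluded by
`not_common_next`, or two, whose own targets are then crosswise, a chain or mutual; all are
impossible. -/
theorem four_lt_card_upper (h₁ : D.next x₁ j₁ ≠ x₂) (h₂ : D.next x₂ j₂ ≠ x₁) :
    4 < (D.upper a).card := by
  by_contra! hM
  have mx₁ : x₁ ∈ D.upper a := F.mem_upper_iff.2 ⟨_, F.Z_e₁⟩
  have mx₂ : x₂ ∈ D.upper a := F.mem_upper_iff.2 ⟨_, F.Z_e₂⟩
  obtain ⟨u₁, hu₁⟩ : ∃ u, D.next x₁ j₁ = u := ⟨_, rfl⟩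
  obtain ⟨u₂, hu₂⟩ : ∃ u, D.next x₂ j₂ = u := ⟨_, rfl⟩
  rw [hu₁] at h₁
  rw [hu₂] at h₂
  have mu₁ : u₁ ∈ D.upper a := hu₁ ▸ F.next_mem_upper F.Z_e₁
  have mu₂ : u₂ ∈ D.upper a := hu₂ ▸ F.next_mem_upper F.Z_e₂
  have hu₁x₁ : u₁ ≠ x₁ := hu₁ ▸ next_ne_self _ _
  have hu₂x₂ : u₂ ≠ x₂ := hu₂ ▸ next_ne_self _ _
  have nx₁ : ∀ l, D.next u₁ l ≠ x₁ := fun l hl => next_next_ne x₁ j₁ l (by rw [hu₁, hl])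
  have nx₂ : ∀ l, D.next u₂ l ≠ x₂ := fun l hl => next_next_ne x₂ j₂ l (by rw [hu₂, hl])
  obtain ⟨k, hk⟩ := F.mem_upper_iff.1 mu₁
  obtain ⟨l, hl⟩ := F.mem_upper_iff.1 mu₂
  rcases eq_or_ne u₁ u₂ with rfl | hu
  · obtain ⟨y, hy⟩ : ∃ y, D.next u₁ k = y := ⟨_, rfl⟩
    have my : y ∈ D.upper a := hy ▸ F.next_mem_upper hk
    have hyx₁ : y ≠ x₁ := hy ▸ nx₁ k
    have hyx₂ : y ≠ x₂ := hy ▸ nx₂ k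
    have hyu : y ≠ u₁ := hy ▸ next_ne_self _ _
    obtain ⟨-, hfour⟩ := eq_or_of_card_le_four hM mx₁ mx₂ mu₁ my F.ne hu₁x₁.symm hyx₁.symm
      hu₂x₂.symm hyx₂.symm hyu.symm
    obtain ⟨r, hr⟩ := F.mem_upper_iff.1 my
    rcases hfour _ (F.next_mem_upper hr) with h' | h' | h' | h'
    · exact F.symm.not_common_next hu₂ hu₁ hk hy hr h'
    · exact F.not_common_next hu₁ hu₂ hk hy hr h'
    · exact next_next_ne u₁ k r (by rw [hy, h'])
    · exact next_ne_self _ _ h'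
  · obtain ⟨-, hfour⟩ := eq_or_of_card_le_four hM mx₁ mx₂ mu₁ mu₂ F.ne hu₁x₁.symm h₂.symm
      h₁.symm hu₂x₂.symm hu
    have next_u₁ : ∀ l, 0 < Z (D.tip u₁ l) → D.next u₁ l = x₂ ∨ D.next u₁ l = u₂ := by
      intro l hl
      rcases hfour _ (F.next_mem_upper hl) with h' | h' | h' | h'
      · exact (nx₁ l h').elim
      · exact Or.inl h'
      · exact (next_ne_self _ _ h').elim
      · exact Or.inr h'
    have next_u₂ : ∀ l, 0 < Z (D.tip u₂ l) → D.next u₂ l = x₁ ∨ D.next u₂ l = u₁ := by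
      intro l hl
      rcases hfour _ (F.next_mem_upper hl) with h' | h' | h' | h'
      · exact Or.inl h'
      · exact (nx₂ l h').elim
      · exact Or.inr h'
      · exact (next_ne_self _ _ h').elim
    rcases next_u₁ k hk with h | h <;> rcases next_u₂ l hl with h' | h'
    · exact F.not_crosswise hu₁ hu₂ hu hk hl h h'
    · refine F.symm.not_chain hu₂ hu₁ hk (not_lt.1 fun hk' => ?_) h h'
      rcases next_u₁ _ hk' with h'' | h''
      · exact next_ne_next_not u₁ k (h.trans h''.symm)
      · exact next_next_ne u₁ _ l (by rw [h'', h'])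
    · refine F.not_chain hu₁ hu₂ hl (not_lt.1 fun hl' => ?_) h' h
      rcases next_u₂ _ hl' with h'' | h''
      · exact next_ne_next_not u₂ l (h'.trans h''.symm)
      · exact next_next_ne u₂ _ k (by rw [h'', h])
    · exact next_next_ne u₁ k l (by rw [h, h'])

end Frame

theorem tight_of_card_upper_le {a : ι} (hM : (D.upper a).card ≤ 4) : D.Tight a := by
  obtain ⟨j₁, h1, h1'⟩ := exists_sides (D := D) a false
  obtain ⟨j₂, h2, h2'⟩ := exists_sides (D := D) a true
  have F : Frame D a (D.next a false) (D.next a true) j₁ j₂ (D.normal (D.next a true))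
      (D.normal (D.next a false)) (-D.normal a) (D.tip a false) (D.tip a true) :=
    { X_ξ₁ := D.normal_pos a true
      Y_ξ₁ := normal_eq_zero (tip_mem_cone a false)
      Z_ξ₁ := by simp [D.normal_tip]
      X_ξ₂ := normal_eq_zero (tip_mem_cone a true)
      Y_ξ₂ := D.normal_pos a false
      Z_ξ₂ := by simp [D.normal_tip]
      Z_e₁ := by simpa using h1
      Z_e₂ := by simpa using h2
      Z_e₁' := by simpa using h1'
      Z_e₂' := by simpa using h2'
      ξ₁_mem := tip_mem_cone a false
      ξ₂_mem := tip_mem_cone a true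
      cone_a := fun s t hs ht => ⟨s, t, hs, ht, rfl⟩
      X_eq := rfl
      Y_eq := rfl
      Z_eq := rfl }
  by_cases e₂ : D.next (D.next a true) j₂ = D.next a false
  · exact F.tight_of_hit hM rfl e₂
  by_cases e₁ : D.next (D.next a false) j₁ = D.next a true
  · exact F.symm.tight_of_hit hM rfl e₁
  · exact absurd hM (F.four_lt_card_upper e₁ e₂).not_ge

end Fintype
end ConeDiagram
end SphericalOcclusion

/-! ### Counting incidences and semicircles. -/

namespace SphericalOcclusion
namespace ConeDiagram

variable {ι κ V : Type*} [AddCommGroup V] [Module ℝ V] {D : ConeDiagram ι κ V}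

/-- A semicircle leaving the clean side of `a` covers at most one arc that does so. -/
theorem eq_of_key_eq_of_leaves {a b b' : ι} {j j' : Bool} (hk : D.key b = D.key b')
    (h1 : D.normal a (D.tip b j) < 0) (h2 : 0 ≤ D.normal a (D.tip b (!j)))
    (h1' : D.normal a (D.tip b' j') < 0) (h2' : 0 ≤ D.normal a (D.tip b' (!j'))) : b = b' := by
  set f := D.normal a
  have crossing : ∀ (b : ι) (j : Bool), f (D.tip b j) < 0 → 0 ≤ f (D.tip b (!j)) →
      f (D.tip b (!j)) • D.tip b j + (-f (D.tip b j)) • D.tip b (!j) ∈ D.half (D.key b) ∧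
      f (f (D.tip b (!j)) • D.tip b j + (-f (D.tip b j)) • D.tip b (!j)) = 0 := by
    intro b j h1 h2
    refine ⟨?_, ?_⟩
    · rw [add_comm]
      exact comb_mem_half (tip_mem_half _ _) (tip_mem_half _ _) (by linarith) h2
    · simp only [map_add, map_smul, smul_eq_mul]
      ring
  obtain ⟨hg, fg⟩ := crossing b j h1 h2
  obtain ⟨hg', fg'⟩ := crossing b' j' h1' h2'
  obtain ⟨r, hr, hrg⟩ := exists_smul_eq hg (hk ▸ hg') (tip_mem_half b j) fg fg' h1.ne
  obtain ⟨α, β, hαβ⟩ := exists_eq_of_mem_half (D := D) j (hk ▸ tip_mem_half b' j')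
  set A := f (D.tip b (!j)) with hA
  set B := -f (D.tip b j) with hB
  have hB0 : 0 < B := by linarith
  -- If the other tip of `b` lies on the plane of `a`, then `A = 0` and positivity must come from
  -- `α`.
  have hα : 0 < A ∨ 0 < α := by
    rcases eq_or_lt_of_le h2 with h | h
    · right
      have h3 : f (D.tip b' j') = α * f (D.tip b j) := by
        rw [hαβ]
        simp only [map_add, map_smul, smul_eq_mul]
        rw [← hA, ← h, mul_zero, add_zero]
      by_contra! h4
      nlinarith [mul_nonneg_of_nonpos_of_nonpos h4 h1.le]
    · exact Or.inl h
  have small : ∀ {x y ε : ℝ}, 0 < x → 0 < ε → ε ≤ x / (1 + |y|) → 0 < x + ε * y := by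
    intro x y ε hx hε h
    rw [le_div_iff₀ (by positivity)] at h
    nlinarith [neg_abs_le y]
  -- Both arcs cross the plane of `a` on one ray; a small step from it into the clean side stays in
  -- both cones.
  obtain ⟨ε, hε, hεA, hεB⟩ : ∃ ε : ℝ, 0 < ε ∧ 0 < r * A + ε * α ∧ 0 < r * B + ε * β := by
    rcases hα with hA | hα
    · exact ⟨min (r * A / (1 + |α|)) (r * B / (1 + |β|)), by positivity,
        small (by positivity) (by positivity) (min_le_left _ _),
        small (by positivity) (by positivity) (min_le_right _ _)⟩
    · exact ⟨r * B / (1 + |β|), by positivity, by positivity,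
        small (by positivity) (by positivity) le_rfl⟩
  refine eq_of_mem_cone (D := D) (x := f (D.tip b' (!j')) • D.tip b' j' +
    (-f (D.tip b' j')) • D.tip b' (!j') + ε • D.tip b' j') ?_ ?_
  · refine (mem_cone_iff j).2 ⟨r * A + ε * α, r * B + ε * β, hεA, hεB, ?_⟩
    rw [hrg, hαβ]
    module
  · exact (mem_cone_iff j').2 ⟨f (D.tip b' (!j')) + ε, -f (D.tip b' j'), by positivity,
      by linarith, by module⟩

/-- A semicircle leaving the clean side of `a` does not cover an arc that feeds into `a`. -/
theorem key_ne_of_leaves {a b z : ι} {i j : Bool} (h1 : D.normal a (D.tip b j) < 0)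
    (h2 : 0 ≤ D.normal a (D.tip b (!j))) (hz : D.next z i = a) : D.key b ≠ D.key z := by
  intro hk
  have hza : D.tip z i ∈ D.cone a := hz ▸ tip_mem_cone z i
  have hg : D.normal a (D.tip b (!j)) • D.tip b j + (-D.normal a (D.tip b j)) • D.tip b (!j)
      ∈ D.half (D.key b) := by
    rw [add_comm]
    exact comb_mem_half (tip_mem_half _ _) (tip_mem_half _ _) (by linarith) h2
  obtain ⟨r, hr, hrg⟩ := exists_smul_eq (f := D.normal a) (hk ▸ tip_mem_half z i) hg
    (tip_mem_half b j) (normal_eq_zero hza)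
    (by simp only [map_add, map_smul, smul_eq_mul]; ring) h1.ne
  refine crossing_notMem_cone h1 h2 ?_
  rw [hrg]
  exact smul_mem_cone hza hr

section Count

variable [Fintype ι]

theorem sum_card_feeders : ∑ a, (D.feeders a).card = 2 * Fintype.card ι := by
  classical
  have h := Finset.card_eq_sum_card_fiberwise (f := fun q : ι × Bool => D.next q.1 q.2)
    (s := Finset.univ) (t := Finset.univ) fun q _ => Finset.mem_coe.2 (Finset.mem_univ _)
  rw [Finset.card_univ, Fintype.card_prod, Fintype.card_bool] at h
  rw [mul_comm, h]
  refine Finset.sum_congr rfl fun a _ => congrArg _ ?_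
  ext q
  simp [mem_feeders]

open Classical in
theorem card_image_feeders (a : ι) :
    ((D.feeders a).image Prod.fst).card = (D.feeders a).card := by
  refine Finset.card_image_of_injOn ?_
  rintro ⟨z, i⟩ hz ⟨z', i'⟩ hz' (rfl : z = z')
  exact congrArg _ (eq_of_next_eq (b := z) ((mem_feeders.1 hz).trans (mem_feeders.1 hz').symm))

open Classical in
theorem card_insert_union (a : ι) :
    (insert a (D.upper a ∪ (D.feeders a).image Prod.fst)).card =
      (D.upper a).card + (D.feeders a).card + 1 := by
  rw [Finset.card_insert_of_notMem, Finset.card_union_of_disjoint, card_image_feeders]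
  · refine Finset.disjoint_right.2 fun b hb => ?_
    obtain ⟨⟨b, i⟩, hq, rfl⟩ := Finset.mem_image.1 hb
    exact notMem_upper_of_next (mem_feeders.1 hq)
  · rw [Finset.mem_union, not_or]
    refine ⟨self_notMem_upper a, fun h => ?_⟩
    obtain ⟨⟨b, i⟩, hq, rfl⟩ := Finset.mem_image.1 h
    exact next_ne_self _ _ (mem_feeders.1 hq)

theorem card_upper_add_le (a : ι) :
    (D.upper a).card + (D.feeders a).card + 1 ≤ Fintype.card ι := by
  classical
  rw [← card_insert_union]
  exact Finset.card_le_univ _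

variable [DecidableEq κ]

variable (D) in
/-- The semicircles that cover some arc. -/
def keys : Finset κ := Finset.univ.image D.key

variable (D) in
/-- The incidences whose hitting arc or whose hit arc is covered by the semicircle `c`. -/
def touching (c : κ) : Finset (ι × Bool) :=
  Finset.univ.filter fun q => D.key q.1 = c ∨ D.key (D.next q.1 q.2) = c

theorem key_mem_keys (a : ι) : D.key a ∈ D.keys := Finset.mem_image_of_mem _ (Finset.mem_univ a)

/-- Sending an incidence to its other semicircle is injective and misses both the given semicircle
and one disjoint from it. -/
theorem card_touching_add_two_le (a : ι) : (D.touching (D.key a)).card + 2 ≤ D.keys.card := by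
  obtain ⟨b, hb⟩ := exists_disjoint_half (D := D) a
  have hab : D.key b ≠ D.key a := fun h =>
    Set.disjoint_left.1 hb (tip_mem_half a false) (h ▸ tip_mem_half a false)
  have hcard : ((D.keys.erase (D.key a)).erase (D.key b)).card + 2 = D.keys.card := by
    have h1 := Finset.card_erase_add_one (key_mem_keys (D := D) a)
    have h2 := Finset.card_erase_add_one (Finset.mem_erase.2 ⟨hab, key_mem_keys (D := D) b⟩)
    omega
  rw [← hcard]
  refine Nat.add_le_add_right ?_ 2
  refine Finset.card_le_card_of_injOn
    (fun q => if D.key q.1 = D.key a then D.key (D.next q.1 q.2) else D.key q.1) ?_ ?_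
  · rintro ⟨z, i⟩ hq
    simp only [touching, Finset.coe_filter, Finset.mem_univ, true_and, Set.mem_ofPred_eq] at hq
    have h3 := tip_mem_half (D := D) z i
    have h4 := cone_subset_half _ (tip_mem_cone (D := D) z i)
    simp only [Finset.coe_erase, Set.mem_sdiff, Set.mem_singleton_iff, Finset.mem_coe]
    split_ifs with h
    · refine ⟨⟨key_mem_keys _, fun h' => key_next_ne z i (h'.trans h.symm)⟩, fun h' => ?_⟩
      exact Set.disjoint_left.1 hb (h ▸ h3) (h' ▸ h4)
    · refine ⟨⟨key_mem_keys _, h⟩, fun h' => ?_⟩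
      exact Set.disjoint_left.1 hb (hq.resolve_left h ▸ h4) (h' ▸ h3)
  · rintro ⟨z, i⟩ hq ⟨z', i'⟩ hq' heq
    simp only [touching, Finset.coe_filter, Finset.mem_univ, true_and, Set.mem_ofPred_eq]
      at hq hq' heq
    suffices z = z' ∧ i = i' by rw [this.1, this.2]
    split_ifs at heq with h h' h'
    · exact eq_of_key_eq (h.trans h'.symm) heq
    · exact (key_ne_of_key_eq (h.trans (hq'.resolve_left h').symm) heq).elim
    · exact (key_ne_of_key_eq (h'.trans (hq.resolve_left h).symm) heq.symm).elim
    · exact eq_of_key_eq heq ((hq.resolve_left h).trans (hq'.resolve_left h').symm)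

theorem card_touching (c : κ) : (D.touching c).card =
    (Finset.univ.filter fun q : ι × Bool => D.key q.1 = c).card +
      (Finset.univ.filter fun q : ι × Bool => D.key (D.next q.1 q.2) = c).card := by
  classical
  rw [touching, Finset.filter_or, Finset.card_union_of_disjoint]
  refine Finset.disjoint_filter.2 fun q _ h1 h2 => key_next_ne q.1 q.2 (h2.trans h1.symm)

theorem four_mul_card_le : 4 * Fintype.card ι ≤ D.keys.card * (D.keys.card - 2) := by
  have h1 := Finset.card_eq_sum_card_fiberwise (f := fun q : ι × Bool => D.key q.1)
    (s := Finset.univ) (t := D.keys) fun q _ => key_mem_keys _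
  have h2 := Finset.card_eq_sum_card_fiberwise (f := fun q : ι × Bool => D.key (D.next q.1 q.2))
    (s := Finset.univ) (t := D.keys) fun q _ => key_mem_keys _
  have h3 : ∑ c ∈ D.keys, (D.touching c).card ≤ D.keys.card * (D.keys.card - 2) := by
    rw [← smul_eq_mul]
    refine Finset.sum_le_card_nsmul _ _ _ fun c hc => ?_
    obtain ⟨a, -, rfl⟩ := Finset.mem_image.1 hc
    have := card_touching_add_two_le (D := D) a
    omega
  simp only [card_touching, Finset.sum_add_distrib] at h3
  rw [← h1, ← h2, Finset.card_univ, Fintype.card_prod, Fintype.card_bool] at h3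
  omega

/-- `D.key` is injective on `a`, its feeders and the four upper arcs: since these four all leave the
hemisphere, a semicircle covers at most one of them, and then no feeder. -/
theorem Tight.card_feeders_add_le {a : ι} (h : D.Tight a) :
    (D.feeders a).card + 5 ≤ D.keys.card := by
  classical
  obtain ⟨h4, hl, -⟩ := h
  have hcard := card_insert_union (D := D) a
  rw [h4] at hcard
  rw [show (D.feeders a).card + 5 = 4 + (D.feeders a).card + 1 by omega, ← hcard]
  refine Finset.card_le_card_of_injOn D.key (fun b _ => key_mem_keys b) ?_
  have upper_ne : ∀ b ∈ D.upper a, D.key b ≠ D.key a := by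
    intro b hb hk
    obtain ⟨j, hj⟩ := mem_upper.1 hb
    rw [eq_zero_on_half (D.normal_tip a) (hk ▸ tip_mem_half b j)] at hj
    exact hj.false
  have cases : ∀ b ∈ (insert a (D.upper a ∪ (D.feeders a).image Prod.fst) : Finset ι),
      b = a ∨ b ∈ D.upper a ∨ ∃ i, D.next b i = a := by
    intro b hb
    rw [Finset.mem_insert, Finset.mem_union, Finset.mem_image] at hb
    rcases hb with hb | hb | ⟨⟨b, i⟩, hq, rfl⟩
    · exact Or.inl hb
    · exact Or.inr (Or.inl hb)
    · exact Or.inr (Or.inr ⟨i, mem_feeders.1 hq⟩)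
  intro b hb b' hb' hk
  rcases cases b hb with rfl | hb | ⟨i, hi⟩ <;> rcases cases b' hb' with rfl | hb' | ⟨i', hi'⟩
  · rfl
  · exact (upper_ne b' hb' hk.symm).elim
  · exact (key_next_ne b' i' (hi' ▸ hk)).elim
  · exact (upper_ne b hb hk).elim
  · obtain ⟨j, h1, h2⟩ := hl b hb
    obtain ⟨j', h1', h2'⟩ := hl b' hb'
    exact eq_of_key_eq_of_leaves hk h1 h2 h1' h2'
  · obtain ⟨j, h1, h2⟩ := hl b hb
    exact (key_ne_of_leaves h1 h2 hi' hk).elim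
  · exact (key_next_ne b i (hi ▸ hk.symm)).elim
  · obtain ⟨j, h1, h2⟩ := hl b' hb'
    exact (key_ne_of_leaves h1 h2 hi hk.symm).elim
  · exact (eq_of_key_eq hk (by rw [hi, hi'])).1

theorem eight_le_card_keys [Nonempty ι] : 8 ≤ D.keys.card := by
  classical
  by_contra! hk
  have hn : Fintype.card ι ≤ 8 := by
    have h1 := four_mul_card_le (D := D)
    have h2 : D.keys.card * (D.keys.card - 2) ≤ 7 * 5 := Nat.mul_le_mul (by omega) (by omega)
    omega
  obtain ⟨a, -, hmax⟩ := Finset.exists_max_image Finset.univ (fun a => (D.feeders a).card)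
    Finset.univ_nonempty
  have hsum := sum_card_feeders (D := D)
  have h2 : 2 ≤ (D.feeders a).card := by
    by_contra! h
    have h3 : ∑ a, (D.feeders a).card ≤ Fintype.card ι * 1 := by
      rw [← smul_eq_mul]
      exact Finset.sum_le_card_nsmul _ _ _ fun b hb => (hmax b hb).trans (by omega)
    have := Fintype.card_pos (α := ι)
    omega
  have tight : (D.upper a).card ≤ 4 → D.Tight a := tight_of_card_upper_le
  have hup := card_upper_add_le (D := D) a
  rcases le_or_gt 3 (D.feeders a).card with h3 | h3
  -- At most eight arcs, minus `a` and three feeders, leave at most four upper ones.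
  · have := (tight (by omega)).card_feeders_add_le
    omega
  rcases le_or_gt (Fintype.card ι) 7 with h7 | h7
  · obtain ⟨-, -, x, hx⟩ := tight (by omega)
    have := hmax x (Finset.mem_univ x)
    omega
  -- every arc is hit exactly twice, and two of the eight arcs share a semicircle
  have heq : ∀ x, (D.feeders x).card = 2 := by
    have hle : ∀ x ∈ Finset.univ, (D.feeders x).card ≤ 2 := fun x hx =>
      (hmax x hx).trans (by omega)
    have := (Finset.sum_eq_sum_iff_of_le hle).1 (by
      rw [hsum, Finset.sum_const, Finset.card_univ, smul_eq_mul, mul_comm])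
    exact fun x => this x (Finset.mem_univ x)
  obtain ⟨b, -, b', -, hne, hbb⟩ := Finset.exists_ne_map_eq_of_card_lt_of_maps_to
    (s := Finset.univ) (t := D.keys) (f := D.key)
    (by rw [Finset.card_univ]; omega) fun b _ => key_mem_keys b
  -- The shared semicircle has four outgoing incidences and, below, four incoming ones.
  have hA : 4 ≤ (Finset.univ.filter fun q : ι × Bool => D.key q.1 = D.key b).card := by
    have h5 : (({b, b'} : Finset ι) ×ˢ (Finset.univ : Finset Bool)).card = 4 := by
      rw [Finset.card_product, Finset.card_pair hne, Finset.card_univ, Fintype.card_bool]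
    rw [← h5]
    refine Finset.card_le_card fun q hq => ?_
    simp only [Finset.mem_product, Finset.mem_insert, Finset.mem_singleton] at hq
    rw [Finset.mem_filter]
    rcases hq.1 with h | h <;> simp [h, hbb]
  have hB : 4 ≤ (Finset.univ.filter
      fun q : ι × Bool => D.key (D.next q.1 q.2) = D.key b).card := by
    have hdisj : Disjoint (D.feeders b) (D.feeders b') := Finset.disjoint_left.2 fun q h h' =>
      hne ((mem_feeders.1 h).symm.trans (mem_feeders.1 h'))
    have h5 : (D.feeders b ∪ D.feeders b').card = 4 := by
      rw [Finset.card_union_of_disjoint hdisj, heq, heq]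
    rw [← h5]
    refine Finset.card_le_card fun q hq => ?_
    rw [Finset.mem_union, mem_feeders, mem_feeders] at hq
    rw [Finset.mem_filter]
    rcases hq with h | h <;> simp [h, hbb]
  have h6 := card_touching_add_two_le (D := D) b
  rw [card_touching] at h6
  omega

end Count
end ConeDiagram
end SphericalOcclusion

/-! ### From spherical arcs to the cone model. -/

namespace SphericalOcclusion
namespace GreatArc

/-- The endpoints of an arc, indexed by `Bool`. -/
noncomputable def tip (a : GreatArc) (i : Bool) : E3 := a.point (bif i then a.length else 0)

theorem inner_dir_start (a : GreatArc) : ⟪a.dir, a.start⟫ = 0 := by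
  rw [real_inner_comm, a.inner_start_dir]

theorem inner_dir_dir (a : GreatArc) : ⟪a.dir, a.dir⟫ = 1 := by
  rw [real_inner_self_eq_norm_sq, a.norm_dir, one_pow]

theorem inner_start_start (a : GreatArc) : ⟪a.start, a.start⟫ = 1 := by
  rw [real_inner_self_eq_norm_sq, a.norm_start, one_pow]

theorem norm_point (a : GreatArc) (t : ℝ) : ‖a.point t‖ = 1 := by
  have h : ‖a.point t‖ ^ 2 = 1 := by
    rw [← real_inner_self_eq_norm_sq]
    simp only [point, inner_add_left, inner_add_right, real_inner_smul_left, real_inner_smul_right,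
      a.inner_start_start, a.inner_dir_dir, a.inner_start_dir, a.inner_dir_start]
    linear_combination Real.sin_sq_add_cos_sq t
  nlinarith [norm_nonneg (a.point t)]

theorem inner_dir_point (a : GreatArc) (t : ℝ) : ⟪a.dir, a.point t⟫ = Real.sin t := by
  simp [point, inner_add_right, real_inner_smul_right, a.inner_dir_start, a.norm_dir]

theorem eq_zero_of_comb (a : GreatArc) {s t : ℝ} (h : s • a.start + t • a.dir = 0) :
    s = 0 ∧ t = 0 := by
  constructor
  · have := congrArg (fun x => ⟪a.start, x⟫) h
    simpa [inner_add_right, real_inner_smul_right, a.norm_start, a.inner_start_dir] using this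
  · have := congrArg (fun x => ⟪a.dir, x⟫) h
    simpa [inner_add_right, real_inner_smul_right, a.inner_dir_start, a.norm_dir] using this

theorem comb_tip (a : GreatArc) (s t : ℝ) : s • a.tip false + t • a.tip true =
    (s + t * Real.cos a.length) • a.start + (t * Real.sin a.length) • a.dir := by
  simp only [tip, point, cond_false, cond_true, Real.cos_zero, Real.sin_zero]
  module

section Short

variable {a : GreatArc} (ha : a.length < Real.pi)
include ha

theorem sin_length_pos : 0 < Real.sin a.length := Real.sin_pos_of_pos_of_lt_pi a.length_pos ha

theorem tip_indep {s t : ℝ} (h : s • a.tip false + t • a.tip true = 0) : s = 0 ∧ t = 0 := by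
  rw [comb_tip] at h
  obtain ⟨h1, h2⟩ := a.eq_zero_of_comb h
  have ht : t = 0 := (mul_eq_zero.1 h2).resolve_right (sin_length_pos ha).ne'
  subst ht
  exact ⟨by simpa using h1, rfl⟩

theorem relInterior_subset_openCone : a.relInterior ⊆ openCone (a.tip false) (a.tip true) := by
  rintro x ⟨t, ⟨ht0, htL⟩, rfl⟩
  have hL := sin_length_pos ha
  refine ⟨Real.sin (a.length - t) / Real.sin a.length, Real.sin t / Real.sin a.length,
    div_pos (Real.sin_pos_of_pos_of_lt_pi (by linarith) (by linarith)) hL,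
    div_pos (Real.sin_pos_of_pos_of_lt_pi ht0 (by linarith)) hL, ?_⟩
  rw [comb_tip, point, Real.sin_sub]
  match_scalars
  · field_simp
    ring
  · field_simp

/-- Polar coordinates in the plane of the arc, with `start` as real axis: positivity of both
coefficients keeps the argument strictly between `0` and the length. -/
theorem exists_point_of_mem_openCone {x : E3} (hx : x ∈ openCone (a.tip false) (a.tip true)) :
    ∃ r t : ℝ, 0 < r ∧ t ∈ Set.Ioo 0 a.length ∧ x = r • a.point t := by
  obtain ⟨s, t, hs, ht, rfl⟩ := hx
  have hL := sin_length_pos ha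
  set A := s + t * Real.cos a.length
  set B := t * Real.sin a.length with hB
  have hB0 : 0 < B := mul_pos ht hL
  set z : ℂ := ⟨A, B⟩
  have hc : ‖z‖ * Real.cos z.arg = A := Complex.norm_mul_cos_arg z
  have hsn : ‖z‖ * Real.sin z.arg = B := Complex.norm_mul_sin_arg z
  have hz : 0 < ‖z‖ := norm_pos_iff.2 fun h => hB0.ne' (congrArg Complex.im h)
  have hsin : 0 < Real.sin z.arg := pos_of_mul_pos_right (hsn ▸ hB0) hz.le
  have h0 : 0 < z.arg := by
    by_contra! h
    exact hsin.not_ge (Real.sin_nonpos_of_nonpos_of_neg_pi_le h (Complex.neg_pi_lt_arg z).le)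
  have hlt : z.arg < a.length := by
    by_contra! h
    have h1 : 0 ≤ Real.sin (z.arg - a.length) :=
      Real.sin_nonneg_of_nonneg_of_le_pi (by linarith)
        (by linarith [Complex.arg_le_pi z, a.length_pos])
    have h2 : ‖z‖ * Real.sin (z.arg - a.length) = -(s * Real.sin a.length) := by
      rw [Real.sin_sub]
      linear_combination Real.cos a.length * hsn - Real.sin a.length * hc
    nlinarith [mul_nonneg hz.le h1, mul_pos hs hL]
  refine ⟨‖z‖, z.arg, hz, ⟨h0, hlt⟩, ?_⟩
  rw [comb_tip, point, smul_add, smul_smul, smul_smul, hc, hsn]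

theorem inv_norm_smul_mem_relInterior {x : E3} (hx : x ∈ openCone (a.tip false) (a.tip true)) :
    ‖x‖⁻¹ • x ∈ a.relInterior := by
  obtain ⟨r, t, hr, ht, rfl⟩ := exists_point_of_mem_openCone ha hx
  refine ⟨t, ht, ?_⟩
  rw [norm_smul, norm_point, mul_one, Real.norm_of_nonneg hr.le, smul_smul,
    inv_mul_cancel₀ hr.ne', one_smul]

end Short

theorem tip_mem_carrier (a : GreatArc) (i : Bool) : a.tip i ∈ a.carrier := by
  cases i
  · exact ⟨0, ⟨le_rfl, a.length_pos.le⟩, rfl⟩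
  · exact ⟨a.length, ⟨a.length_pos.le, le_rfl⟩, rfl⟩

/-- The ends are the only antipodal points of a closed semicircle, so the relative interior depends
on the point set alone and carriers can serve as keys. -/
theorem IsGreatSemicircle.relInterior_eq {c : GreatArc} (hc : c.IsGreatSemicircle) :
    c.relInterior = {x | x ∈ c.carrier ∧ -x ∉ c.carrier} := by
  have hpi : c.length = Real.pi := hc
  have inner_nonneg : ∀ x ∈ c.carrier, 0 ≤ ⟪c.dir, x⟫ := by
    rintro x ⟨t, ⟨h0, h1⟩, rfl⟩
    rw [inner_dir_point]
    exact Real.sin_nonneg_of_nonneg_of_le_pi h0 (hpi ▸ h1)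
  have hneg : -c.point 0 = c.point Real.pi := by simp [point]
  ext x
  constructor
  · rintro ⟨t, ht, rfl⟩
    refine ⟨⟨t, Set.Ioo_subset_Icc_self ht, rfl⟩, fun h => ?_⟩
    have h1 := inner_nonneg _ h
    rw [inner_neg_right, inner_dir_point] at h1
    have := Real.sin_pos_of_pos_of_lt_pi ht.1 (hpi ▸ ht.2)
    linarith
  · rintro ⟨⟨t, ⟨h0, h1⟩, rfl⟩, h⟩
    refine ⟨t, ⟨lt_of_le_of_ne h0 ?_, lt_of_le_of_ne h1 ?_⟩, rfl⟩
    · rintro rfl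
      exact h ⟨c.length, ⟨c.length_pos.le, le_rfl⟩, by rw [hneg, hpi]⟩
    · rintro rfl
      exact h ⟨0, ⟨le_rfl, c.length_pos.le⟩, by rw [hpi, ← hneg, neg_neg]⟩

theorem IsGreatSemicircle.exists_comb {c : GreatArc} (hc : c.IsGreatSemicircle) {x : E3}
    (hx : x ∈ c.relInterior) : ∃ s r : ℝ, 0 < r ∧ x = s • c.start + r • c.dir := by
  obtain ⟨t, ht, rfl⟩ := hx
  exact ⟨_, _, Real.sin_pos_of_pos_of_lt_pi ht.1 (lt_of_lt_of_eq ht.2 hc), rfl⟩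

end GreatArc

namespace IsSOD

variable {S C : Set GreatArc}

/-- The two hit arcs have disjoint interiors, so they are hit at different points, which exhaust the
ends of `a`. -/
theorem exists_tip_mem (hS : IsSOD S) {a : GreatArc} (ha : a ∈ S) (i : Bool) :
    ∃ b ∈ S, a.tip i ∈ b.relInterior := by
  obtain ⟨b, hb, c, hc, hbc, ⟨p, hp, hpb⟩, ⟨q, hq, hqc⟩⟩ := hS.feeds_two a ha
  have hpq : p ≠ q := by
    rintro rfl
    exact Set.disjoint_left.1 (hS.disjoint b hb c hc hbc) hpb hqc
  have hi : a.tip i = p ∨ a.tip i = q := by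
    rcases hp with rfl | rfl <;> rcases hq with rfl | rfl <;> cases i <;>
      first | exact (hpq rfl).elim | exact Or.inl rfl | exact Or.inr rfl
  rcases hi with h | h
  · exact ⟨b, hb, h ▸ hpb⟩
  · exact ⟨c, hc, h ▸ hqc⟩

theorem tip_mem_endpoints (a : GreatArc) (i : Bool) : a.tip i ∈ a.endpoints := by
  cases i
  · exact Or.inl rfl
  · exact Or.inr rfl

theorem exists_coneDiagram (hS : IsSOD S) (hC : IsSemicircleCover S C) :
    ∃ D : ConeDiagram S (Set E3) E3, ∀ a, D.key a ∈ GreatArc.carrier '' C := by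
  classical
  choose! cov cov_mem cov_sub using hC.covers
  choose! n hn side using hS.same_side
  choose! next next_mem tip_mem using fun (a : GreatArc) (ha : a ∈ S) (i : Bool) =>
    hS.exists_tip_mem ha i
  obtain ⟨a₀, ha₀⟩ := hS.nonempty
  -- One parametrization per point set; `a₀` is a default outside the cover, where only the `height`
  -- identities are required.
  have hrep : ∀ K : Set E3, ∃ c : GreatArc, K ∈ GreatArc.carrier '' C → c ∈ C ∧ c.carrier = K := by
    intro K
    by_cases h : K ∈ GreatArc.carrier '' C
    · obtain ⟨c, hc, rfl⟩ := h
      exact ⟨c, fun _ => ⟨hc, rfl⟩⟩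
    · exact ⟨a₀, fun h' => (h h').elim⟩
  choose rep hrep using hrep
  have normal_tip : ∀ a ∈ S, ∀ i, ⟪n a, a.tip i⟫ = 0 := by
    intro a ha i
    obtain ⟨-, h1, h2⟩ := hn a ha
    simp [GreatArc.tip, GreatArc.point, inner_add_right, real_inner_smul_right, h1, h2]
  have tip_cone : ∀ a ∈ S, ∀ i, a.tip i ∈ openCone ((next a i).tip false) ((next a i).tip true) :=
    fun a ha i => GreatArc.relInterior_subset_openCone (hS.short _ (next_mem a ha i))
      (tip_mem a ha i)
  refine ⟨{
    tip := fun a => a.1.tip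
    normal := fun a => innerₗ E3 (n a)
    next := fun a i => ⟨next a i, next_mem a a.2 i⟩
    key := fun a => (cov a).carrier
    rim := fun K => (rep K).start
    apex := fun K => (rep K).dir
    height := fun K => innerₗ E3 (rep K).dir
    finrank_eq := by simp
    tip_indep := fun a s t h => GreatArc.tip_indep (hS.short a a.2) h
    disjoint := ?_
    tip_mem := fun a i => tip_cone a a.2 i
    normal_ne := ?_
    normal_tip := fun a i => normal_tip a a.2 i
    normal_pos := ?_
    height_rim := fun K => (rep K).inner_dir_start
    height_apex := fun K => (rep K).inner_dir_dir
    tip_half := ?_ }, fun a => ⟨cov a, cov_mem a a.2, rfl⟩⟩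
  · intro a b x ha hb
    by_contra hab
    exact Set.disjoint_left.1 (hS.disjoint a a.2 b b.2 fun h => hab (Subtype.ext h))
      (GreatArc.inv_norm_smul_mem_relInterior (hS.short a a.2) ha)
      (GreatArc.inv_norm_smul_mem_relInterior (hS.short b b.2) hb)
  · intro a h
    refine (hn a a.2).1 ((inner_self_eq_zero (𝕜 := ℝ)).1 ?_)
    simpa using congrArg (fun f : E3 →ₗ[ℝ] ℝ => f (n a)) h
  · intro a i
    have hb := next_mem a a.2 i
    have h0 : ⟪n (next a i), a.1.tip i⟫ = 0 := by
      obtain ⟨s, t, -, -, h⟩ := tip_cone a a.2 i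
      rw [h, inner_add_right, real_inner_smul_right, real_inner_smul_right, normal_tip _ hb,
        normal_tip _ hb, mul_zero, mul_zero, add_zero]
    -- (A3) speaks of interior points: at the midpoint the hitting tip contributes zero, so the
    -- other tip is on the positive side.
    have hmid : a.1.point (a.1.length / 2) ∈ a.1.relInterior :=
      ⟨_, ⟨half_pos a.1.length_pos, half_lt_self a.1.length_pos⟩, rfl⟩
    have hpos := side _ hb a a.2 ⟨_, tip_mem_endpoints a i, tip_mem a a.2 i⟩ _ hmid
    obtain ⟨s, t, hs, ht, h⟩ :=
      GreatArc.relInterior_subset_openCone (hS.short a a.2) hmid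
    rw [h, inner_add_right, real_inner_smul_right, real_inner_smul_right] at hpos
    change 0 < ⟪n (next a i), a.1.tip (!i)⟫
    cases i
    · rw [h0, mul_zero, zero_add] at hpos
      exact pos_of_mul_pos_right hpos ht.le
    · rw [h0, mul_zero, add_zero] at hpos
      exact pos_of_mul_pos_right hpos hs.le
  · intro a i
    obtain ⟨h1, h2⟩ := hrep (cov a).carrier ⟨cov a, cov_mem a a.2, rfl⟩
    have hr := hC.semicircle _ h1
    refine hr.exists_comb ?_
    rw [hr.relInterior_eq, h2, ← (hC.semicircle _ (cov_mem a a.2)).relInterior_eq]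
    exact cov_sub a a.2 (a.1.tip_mem_carrier i)

end IsSOD

end SphericalOcclusion

/-- The semicircles of the cover are counted as point sets, so that two parametrizations of the
same great semicircle count once. -/
theorem lemma9 (S C : Set SphericalOcclusion.GreatArc) (hS : SphericalOcclusion.IsSOD S)
    (hC : SphericalOcclusion.IsSemicircleCover S C) :
    8 ≤ (SphericalOcclusion.GreatArc.carrier '' C).encard := by
  classical
  obtain ⟨D, hD⟩ := hS.exists_coneDiagram hC
  have := hS.finite.fintype
  have := hS.nonempty.to_subtype
  have h8 := D.eight_le_card_keys
  calc (8 : ℕ∞) ≤ (D.keys.card : ℕ∞) := by exact_mod_cast h8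
    _ = (D.keys : Set (Set SphericalOcclusion.E3)).encard :=
      (Set.encard_coe_eq_coe_finsetCard _).symm
    _ ≤ _ := Set.encard_le_encard fun K hK => by
      obtain ⟨a, -, rfl⟩ := Finset.mem_image.1 (Finset.mem_coe.1 hK)
      exact hD a
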